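/- Let $d\ge 1$ and let $K(x)=p(x)\,|x|^{-d-2}$ for $x\in\mathbb R^d\setminus\{0\}$, where $p$ is a homogeneous polynomial of degree $2$ with complex coefficients such that the cancellation condition $\int_{\mathbb S^{d-1}}K\,ds=0$ holds. Let $Q=[-\pi,\pi]^d$. Then the Fourier series $$F(\tau)=\sum_{m\in\mathbb Z^d,\ m\ne0}K(m)\,e^{im\cdot\tau}$$ converges in $L^2(Q)$, its sum has a representative $F$ that is continuous on $Q\setminus\{0\}$, and the set $$\mathcal C=\overline{\mathrm{conv}}\,\{F(\tau)\mid \tau\in Q\setminus\{0\}\}\subset\mathbb C$$ (the closed convex hull of the range of $F$) is compact and convex and has the following properties. (1) Let $\Omega\subset\mathbb R^d$ be open, $a\in\mathbb R^d$, $N\ge1$ an integer, $x_m=a+m/N$ for $m\in\mathbb Z^d$, and $\omega=\{m\in\mathbb Z^d\mid x_m\in\Omega\}$. The matrix $T^N=(t_{mn})_{m,n\in\omega}$ with $t_{mn}=N^{-d}K(x_m-x_n)$ for $m\ne n$ and $t_{mm}=0$ defines a bounded linear operator on $\ell^2(\omega)$. For every $\lambda\in\mathbb C\setminus\mathcal C$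 and every $f\in\ell^2(\omega)$ the system $$\lambda u_m-N^{-d}\sum_{n\in\omega,\ n\ne m}K(x_m-x_n)\,u_n=f_m\qquad(m\in\omega)$$ has a unique solution $u\in\ell^2(\omega)$, the operator $\lambda I-T^N$ is invertible, and $$\|(\lambda I-T^N)^{-1}\|_{\mathcal L(\ell^2(\omega))}\le \mathrm{dist}(\lambda,\mathcal C)^{-1}.$$ The set $\mathcal C$ depends only on $p$ (and $d$), not on $\Omega$, $a$, $N$ or $\lambda$. (2) There is a unique bounded linear operator $A$ on $L^2(\mathbb R^d)$ that is given on Schwartz functions $\varphi$ by the principal value convolution $$(A\varphi)(x)=\lim_{\epsilon\to0}\int_{|x-y|>\epsilon}K(x-y)\,\varphi(y)\,dy\qquad\text{for almost every }x,$$ and its numerical range $W(A)=\{(u,Au)\mid u\in L^2(\mathbb R^d),\ \|u\|=1\}$ satisfies $W(A)\subset\mathcal C$. -/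

import Mathlib

open MeasureTheory Filter Topology
open scoped ENNReal SchwartzMap

noncomputable section

/-- The kernel `K(x) = p(x) |x|^{-d-2}` on `ℝ^d`, for a polynomial `p` with complex coefficients.
(At `x = 0` Lean assigns the value `0`; that value is never used below.) -/
def polyKernel {d : ℕ} (p : MvPolynomial (Fin d) ℂ) (x : EuclideanSpace ℝ (Fin d)) : ℂ :=
  MvPolynomial.eval (fun i => (x i : ℂ)) p / (‖x‖ : ℂ) ^ (d + 2)

/-- The cancellation condition `∫_{S^{d-1}} K ds = 0`, with the surface measure on the
Euclidean unit sphere. -/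
def SphericalCancellation {d : ℕ} (K : EuclideanSpace ℝ (Fin d) → ℂ) : Prop :=
  ∫ x : Metric.sphere (0 : EuclideanSpace ℝ (Fin d)) 1, K x
    ∂((volume : Measure (EuclideanSpace ℝ (Fin d))).toSphere) = 0

/-- An integer multi-index as a point of `ℝ^d`. -/
def latticePoint {d : ℕ} (m : Fin d → ℤ) : EuclideanSpace ℝ (Fin d) :=
  WithLp.toLp 2 (fun i => (m i : ℝ))

/-- The period cube `Q = [-π, π]^d`. -/
def periodCube (d : ℕ) : Set (EuclideanSpace ℝ (Fin d)) :=
  {τ | ∀ i, τ i ∈ Set.Icc (-Real.pi) Real.pi}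

/-- `F` is the symbol `F(τ) = ∑_{m ∈ ℤ^d, m ≠ 0} K(m) e^{i m·τ}` of the infinite Toeplitz matrix
with entries `K(m - n)` off the diagonal and `0` on the diagonal: the Fourier series converges
(unconditionally) to `F` in `L²(Q)`, and `F` is the representative which is continuous on
`Q \ {0}`. These conditions determine `F` on `Q \ {0}`. -/
structure IsToeplitzSymbol {d : ℕ} (K F : EuclideanSpace ℝ (Fin d) → ℂ) : Prop where
  memLp : MemLp F 2 (volume.restrict (periodCube d))
  tendsto_sum : Tendsto
    (fun s : Finset {m : Fin d → ℤ // m ≠ 0} =>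
      eLpNorm
        (fun τ => F τ - ∑ m ∈ s, K (latticePoint m.1) *
          Complex.exp (Complex.I * ((inner ℝ (latticePoint m.1) τ : ℝ) : ℂ)))
        2 (volume.restrict (periodCube d)))
    atTop (𝓝 0)
  continuousOn : ContinuousOn F (periodCube d \ {0})

/-- The grid point `x^N_m = a + m / N`. -/
def gridPoint {d : ℕ} (a : EuclideanSpace ℝ (Fin d)) (N : ℕ) (m : Fin d → ℤ) :
    EuclideanSpace ℝ (Fin d) :=
  a + (1 / (N : ℝ)) • latticePoint m

/-- The index set `ω^N = {m ∈ ℤ^d | x^N_m ∈ Ω}`. -/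
def gridIndex {d : ℕ} (Ω : Set (EuclideanSpace ℝ (Fin d))) (a : EuclideanSpace ℝ (Fin d))
    (N : ℕ) : Set (Fin d → ℤ) :=
  {m | gridPoint a N m ∈ Ω}

/-- The entries of the (possibly infinite) matrix `T^N`: `N^{-d} K(x^N_m - x^N_n)` for `m ≠ n`
and `0` for `m = n`. -/
def ddEntry {d : ℕ} (K : EuclideanSpace ℝ (Fin d) → ℂ) (a : EuclideanSpace ℝ (Fin d)) (N : ℕ)
    (m n : Fin d → ℤ) : ℂ :=
  if m = n then 0 else ((N : ℂ) ^ d)⁻¹ * K (gridPoint a N m - gridPoint a N n)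

/-- The Hilbert space `ℓ²(ω)`. -/
abbrev ell2 {d : ℕ} (ω : Set (Fin d → ℤ)) : Type := lp (fun _ : ω => ℂ) 2

/-- `U` solves the delta-delta system
`z u_m - N^{-d} ∑_{n ∈ ω^N, n ≠ m} K(x^N_m - x^N_n) u_n = f_m` for all `m ∈ ω^N`;
convergence of the sums (when `ω^N` is infinite) is part of the condition. -/
def SolvesDD {d : ℕ} (K : EuclideanSpace ℝ (Fin d) → ℂ) (Ω : Set (EuclideanSpace ℝ (Fin d)))
    (a : EuclideanSpace ℝ (Fin d)) (N : ℕ) (z : ℂ) (f U : ell2 (gridIndex Ω a N)) : Prop :=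
  ∀ m : gridIndex Ω a N, ∃ s : ℂ,
    HasSum (fun n : gridIndex Ω a N => ddEntry K a N m n * U n) s ∧ z * U m - s = f m

/-- The bounded operator `T` on `ℓ²(ω^N)` is given by the matrix `T^N`. -/
def IsDDOperator {d : ℕ} (K : EuclideanSpace ℝ (Fin d) → ℂ) (Ω : Set (EuclideanSpace ℝ (Fin d)))
    (a : EuclideanSpace ℝ (Fin d)) (N : ℕ)
    (T : ell2 (gridIndex Ω a N) →L[ℂ] ell2 (gridIndex Ω a N)) : Prop :=
  ∀ (U : ell2 (gridIndex Ω a N)) (m : gridIndex Ω a N),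
    HasSum (fun n : gridIndex Ω a N => ddEntry K a N m n * U n) (T U m)

/-- The Hilbert space `L²(ℝ^d)`. -/
abbrev L2Space (d : ℕ) : Type := Lp ℂ 2 (volume : Measure (EuclideanSpace ℝ (Fin d)))

/-- The bounded operator `A` on `L²(ℝ^d)` is the convolution with the principal value kernel `K`:
for every Schwartz function `φ`,
`(A φ)(x) = lim_{ε → 0} ∫_{|x - y| > ε} K(x - y) φ(y) dy` for almost every `x`.
Since Schwartz functions are dense in `L²(ℝ^d)`, this determines `A`. -/
def IsPVConvolution {d : ℕ} (K : EuclideanSpace ℝ (Fin d) → ℂ)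
    (A : L2Space d →L[ℂ] L2Space d) : Prop :=
  ∀ φ : 𝓢(EuclideanSpace ℝ (Fin d), ℂ), ∀ᵐ x : EuclideanSpace ℝ (Fin d),
    Tendsto (fun ε : ℝ => ∫ y in {y | ε < ‖x - y‖}, K (x - y) * φ y)
      (𝓝[>] 0) (𝓝 (A (φ.toLp 2) x))

/-- The numerical range `W(A) = {(u, A u) | ‖u‖ = 1}` of a bounded operator. -/
def numericalRange {H : Type*} [NormedAddCommGroup H] [InnerProductSpace ℂ H]
    (A : H →L[ℂ] H) : Set ℂ :=
  {z | ∃ u : H, ‖u‖ = 1 ∧ inner ℂ u (A u) = z}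

end

/-!
Write `K` for the kernel. The spherical cancellation condition says exactly that the quadratic form
`p` has trace zero (`trace_eq_zero_of_sphericalCancellation`). Permutations and sign changes of the
coordinates preserve both `ℝ^d` and `ℤ^d`, so a form of trace zero cancels against every radial
weight, for integrals over `ℝ^d` and for sums over `ℤ^d` alike. All later arguments use only this
double cancellation together with size and Lipschitz bounds of degree `-d`; the structure
`CancellingKernel` collects these properties.

**The symbol.** The coefficients `K(m)` are square summable but not summable; their differences in
each coordinate direction are summable. Hence `(e^{2πi t_j} - 1) F(t)` is a continuous function on
the torus for each `j`, and dividing `∑_j conj(e^{2πi t_j} - 1) (e^{2πi t_j} - 1) F(t)` by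
`∑_j |e^{2πi t_j} - 1|²` gives `F` as a function continuous off the origin (`torusSymbol`). It is
bounded (`CancellingKernel.exists_norm_torusSymbol_le`): at `t` the series is cut off at the scale
`N ∼ |t|⁻¹`. In the near part, cancellation on the lattice allows `e^{2πi k·t}` to be replaced by
`e^{2πi k·t} - 1`, while the far part is summed by parts. Both estimates are Riemann sums of the
integrable majorant `min(r, r⁻¹) r^{-d}`.

**The matrices.** By homogeneity the entries of `T^N` are `K(m - n)`, whatever `N` and `a` are.
Thus `T^N` is the compression of multiplication by `F` on `L²` of the torus to the span of the
characters with index in `ω` (`CancellingKernel.exists_toeplitz`), and its quadratic form satisfies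
every affine inequality that holds on the range of `F`. By Hahn–Banach its numerical range lies in
the closed convex hull `C`, and a point off a closed set containing the numerical range is in the
resolvent set, with the resolvent bounded by the inverse distance.

**The principal value operator.** On a Schwartz function, subtracting `η(|z|) φ(x)` with a radial
cutoff `η` turns the principal value into an absolutely convergent integral (`pvConv`), which is the
limit of its Riemann sums over `N⁻¹ ℤ^d`. By lattice cancellation these Riemann sums are the
convolutions with `K` on the lattice (`latticeConv`), which act as the Toeplitz matrix on each
shifted grid. Integrating over the shifts transfers the `L²` bound (by Fatou's lemma) and all affine
bounds for the quadratic form (by dominated convergence) to the limit; density of the Schwartz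
functions gives the operator, its uniqueness and the inclusion of its numerical range in `C`.
-/

/-! ### Quadratic forms and the kernel -/

/-- Euclidean space `ℝ^d`. -/
abbrev Euc (d : ℕ) : Type := EuclideanSpace ℝ (Fin d)

/-- A homogeneous polynomial of degree two is a quadratic form, by Euler's identity applied twice. -/
theorem MvPolynomial.IsHomogeneous.exists_quadratic {d : ℕ} {p : MvPolynomial (Fin d) ℂ}
    (hp : p.IsHomogeneous 2) :
    ∃ a : Fin d → Fin d → ℂ, ∀ x : Fin d → ℂ,
      MvPolynomial.eval x p = ∑ i, ∑ j, a i j * (x i * x j) := by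
  have hC : ∀ i j, ∃ c : ℂ, MvPolynomial.pderiv j (MvPolynomial.pderiv i p) = MvPolynomial.C c := by
    intro i j
    have h : (MvPolynomial.pderiv j (MvPolynomial.pderiv i p)).IsHomogeneous 0 :=
      (hp.pderiv (i := i)).pderiv (i := j)
    exact ⟨_, MvPolynomial.totalDegree_eq_zero_iff_eq_C.1 (Nat.le_zero.1 h.totalDegree_le)⟩
  choose c hc using hC
  refine ⟨fun i j => c i j / 2, fun x => ?_⟩
  have h1 : ∀ i, MvPolynomial.eval x (MvPolynomial.pderiv i p) = ∑ j, x j * c i j := by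
    intro i
    have h := (hp.pderiv (i := i)).sum_X_mul_pderiv
    have h' := congrArg (MvPolynomial.eval x) h
    simp only [hc, map_sum, map_mul, MvPolynomial.eval_X, MvPolynomial.eval_C] at h'
    simpa using h'.symm
  have h2 := congrArg (MvPolynomial.eval x) hp.sum_X_mul_pderiv
  simp only [map_sum, map_mul, MvPolynomial.eval_X, h1] at h2
  have h3 : MvPolynomial.eval x p = (∑ i, x i * ∑ j, x j * c i j) / 2 := by
    rw [h2]; simp
  rw [h3, Finset.sum_div]
  refine Finset.sum_congr rfl fun i _ => ?_
  rw [Finset.mul_sum, Finset.sum_div]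
  exact Finset.sum_congr rfl fun j _ => by ring

/-- Exchange of two coordinates of `ℝ^d`, as an isometry. -/
noncomputable def coordSwap {d : ℕ} (i j : Fin d) :
    Euc d ≃ₗᵢ[ℝ] Euc d :=
  LinearIsometryEquiv.piLpCongrLeft 2 ℝ ℝ (Equiv.swap i j)

/-- Change of the sign of one coordinate of `ℝ^d`, as an isometry. -/
noncomputable def coordNeg {d : ℕ} (i : Fin d) :
    Euc d ≃ₗᵢ[ℝ] Euc d :=
  LinearIsometryEquiv.piLpCongrRight 2
    (fun k => if k = i then LinearIsometryEquiv.neg ℝ else LinearIsometryEquiv.refl ℝ ℝ)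

theorem coordSwap_apply {d : ℕ} (i j k : Fin d) (x : Euc d) :
    coordSwap i j x k = x (Equiv.swap i j k) := by
  simp [coordSwap, LinearIsometryEquiv.piLpCongrLeft_apply, Equiv.piCongrLeft'_apply]

theorem coordNeg_apply {d : ℕ} (i k : Fin d) (x : Euc d) :
    coordNeg i x k = if k = i then - x k else x k := by
  unfold coordNeg
  rw [LinearIsometryEquiv.piLpCongrRight_apply]
  by_cases h : k = i <;> simp [h]

/-- The reflection in the `i`-th coordinate changes the sign of the integrand. -/
theorem integral_mul_radial_of_ne {d : ℕ} {i j : Fin d} (hij : i ≠ j) (g : ℝ → ℝ) :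
    ∫ x : Euc d, x i * x j * g ‖x‖ = 0 := by
  have h := (coordNeg i).measurePreserving.integral_comp
    (coordNeg i).toHomeomorph.measurableEmbedding
    (fun x : Euc d => x i * x j * g ‖x‖)
  simp only [coordNeg_apply, LinearIsometryEquiv.norm_map, if_true, if_neg hij.symm] at h
  simp only [neg_mul, integral_neg] at h
  linarith

theorem integral_sq_mul_radial {d : ℕ} (i j : Fin d) (g : ℝ → ℝ) :
    ∫ x : Euc d, x i * x i * g ‖x‖
      = ∫ x : Euc d, x j * x j * g ‖x‖ := by
  have h := (coordSwap i j).measurePreserving.integral_comp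
    (coordSwap i j).toHomeomorph.measurableEmbedding
    (fun x : Euc d => x i * x i * g ‖x‖)
  simp only [coordSwap_apply, LinearIsometryEquiv.norm_map, Equiv.swap_apply_left] at h
  exact h.symm

theorem norm_latticePoint_comp {d : ℕ} (e : Equiv.Perm (Fin d)) (m : Fin d → ℤ) :
    ‖latticePoint (fun k => m (e k))‖ = ‖latticePoint m‖ := by
  rw [EuclideanSpace.norm_eq, EuclideanSpace.norm_eq]
  congr 1
  exact Equiv.sum_comp e (fun k => ‖latticePoint m k‖ ^ 2)

/-- The reflection in the `i`-th coordinate changes the sign of the summand. -/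
theorem tsum_lattice_mul_radial_of_ne {d : ℕ} {i j : Fin d} (hij : i ≠ j) (g : ℝ → ℝ) :
    ∑' m : Fin d → ℤ, (m i : ℝ) * m j * g ‖latticePoint m‖ = 0 := by
  let e : (Fin d → ℤ) ≃ (Fin d → ℤ) :=
    Function.Involutive.toPerm (fun m k => if k = i then - m k else m k) (by
      intro m; ext k; by_cases h : k = i <;> simp [h])
  have he : ∀ m k, e m k = if k = i then - m k else m k := fun m k => rfl
  have hn : ∀ m, ‖latticePoint (e m)‖ = ‖latticePoint m‖ := by
    intro m
    rw [EuclideanSpace.norm_eq, EuclideanSpace.norm_eq]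
    congr 1
    refine Finset.sum_congr rfl fun k _ => ?_
    by_cases h : k = i <;> simp [latticePoint, he, h]
  have h := e.tsum_eq (fun m : Fin d → ℤ => (m i : ℝ) * m j * g ‖latticePoint m‖)
  simp only [hn] at h
  have h' : ∀ m : Fin d → ℤ, ((e m i : ℤ) : ℝ) * ((e m j : ℤ) : ℝ) * g ‖latticePoint m‖
      = - ((m i : ℝ) * m j * g ‖latticePoint m‖) := by
    intro m; simp [he, hij.symm]
  simp only [h', tsum_neg] at h
  linarith

theorem tsum_lattice_sq_mul_radial {d : ℕ} (i j : Fin d) (g : ℝ → ℝ) :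
    ∑' m : Fin d → ℤ, (m i : ℝ) * m i * g ‖latticePoint m‖
      = ∑' m : Fin d → ℤ, (m j : ℝ) * m j * g ‖latticePoint m‖ := by
  let e : (Fin d → ℤ) ≃ (Fin d → ℤ) :=
    (Equiv.swap i j).arrowCongr (Equiv.refl ℤ)
  have he : ∀ m, e m = fun k => m (Equiv.swap i j k) := by
    intro m; ext k; simp [e, Equiv.arrowCongr]
  have h := e.tsum_eq (fun m : Fin d → ℤ => (m i : ℝ) * m i * g ‖latticePoint m‖)
  simp only [he, norm_latticePoint_comp, Equiv.swap_apply_left] at h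
  exact h.symm

/-- If the off-diagonal entries of `c` vanish and its diagonal entries agree, pairing with `c` only
sees the trace. -/
theorem sum_mul_eq_trace_mul {d : ℕ} (a : Fin d → Fin d → ℂ) (c : Fin d → Fin d → ℝ) (i₀ : Fin d)
    (h1 : ∀ i j, i ≠ j → c i j = 0) (h2 : ∀ i j, c i i = c j j) :
    ∑ i, ∑ j, a i j * (c i j : ℂ) = (∑ i, a i i) * (c i₀ i₀ : ℂ) := by
  rw [Finset.sum_mul]
  refine Finset.sum_congr rfl fun i _ => ?_
  rw [Finset.sum_eq_single i]
  · rw [h2 i i₀]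
  · intro j _ hj; simp [h1 i j hj.symm]
  · simp

theorem abs_coord_le_norm {d : ℕ} (x : Euc d) (i : Fin d) : |x i| ≤ ‖x‖ := by
  simpa using PiLp.norm_apply_le x i

theorem integral_quadratic_mul_radial {d : ℕ} (a : Fin d → Fin d → ℂ) (i₀ : Fin d) (g : ℝ → ℝ)
    (hg : Integrable fun x : Euc d => ‖x‖ ^ 2 * g ‖x‖) :
    ∫ x : Euc d,
        (∑ i, ∑ j, a i j * ((x i : ℂ) * (x j : ℂ))) * (g ‖x‖ : ℂ)
      = (∑ i, a i i) * ((∫ x : Euc d, x i₀ * x i₀ * g ‖x‖ : ℝ) : ℂ) := by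
  have hint : ∀ i j, Integrable fun x : Euc d => x i * x j * g ‖x‖ := by
    intro i j
    have h := hg.bdd_mul (f := fun x : Euc d => x i * x j * (‖x‖ ^ 2)⁻¹) (c := 1)
      (by
        apply Measurable.aestronglyMeasurable
        fun_prop)
      (by
        refine Eventually.of_forall fun x => ?_
        rcases eq_or_ne x 0 with rfl | hx
        · simp
        have hx' : 0 < ‖x‖ := norm_pos_iff.2 hx
        rw [Real.norm_eq_abs, abs_mul, abs_mul, abs_inv, abs_of_pos (pow_pos hx' 2),
          mul_inv_le_iff₀ (by positivity)]
        nlinarith [abs_coord_le_norm x i, abs_coord_le_norm x j, abs_nonneg (x i),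
          abs_nonneg (x j)])
    refine h.congr (Eventually.of_forall fun x => ?_)
    rcases eq_or_ne x 0 with rfl | hx
    · simp
    have hx' : ‖x‖ ≠ 0 := norm_ne_zero_iff.2 hx
    field_simp
  rw [← sum_mul_eq_trace_mul a (fun i j => ∫ x : Euc d, x i * x j * g ‖x‖) i₀
    (fun i j hij => integral_mul_radial_of_ne hij g) (fun i j => integral_sq_mul_radial i j g)]
  have hc : ∀ i j, Integrable fun x : Euc d =>
      a i j * ((x i * x j * g ‖x‖ : ℝ) : ℂ) := fun i j => (hint i j).ofReal.const_mul _
  calc _ = ∫ x : Euc d, ∑ i, ∑ j, a i j * ((x i * x j * g ‖x‖ : ℝ) : ℂ) := by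
        congr 1; ext x
        rw [Finset.sum_mul]
        refine Finset.sum_congr rfl fun i _ => ?_
        rw [Finset.sum_mul]
        refine Finset.sum_congr rfl fun j _ => ?_
        push_cast; ring
    _ = _ := by
        rw [integral_finsetSum _ fun i _ => integrable_finsetSum _ fun j _ => hc i j]
        refine Finset.sum_congr rfl fun i _ => ?_
        rw [integral_finsetSum _ fun j _ => hc i j]
        refine Finset.sum_congr rfl fun j _ => ?_
        rw [integral_const_mul]; exact congrArg _ integral_ofReal

/-- Integrating `p` over the unit ball in polar coordinates gives `0`, while by symmetry the integral
is a positive multiple of the trace. -/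
theorem trace_eq_zero_of_sphericalCancellation {d : ℕ} (hd : 1 ≤ d) {p : MvPolynomial (Fin d) ℂ}
    {a : Fin d → Fin d → ℂ}
    (ha : ∀ x : Fin d → ℂ, MvPolynomial.eval x p = ∑ i, ∑ j, a i j * (x i * x j))
    (hcancel : SphericalCancellation (polyKernel p)) : ∑ i, a i i = 0 := by
  have : NeZero d := ⟨by omega⟩
  let P : Euc d → ℂ := fun x => ∑ i, ∑ j, a i j * ((x i : ℂ) * (x j : ℂ))
  -- The radial weight `g` is the indicator of the unit ball.
  let g : ℝ → ℝ := fun r => if r < 1 then 1 else 0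
  have hsph : ∫ x : Metric.sphere (0 : Euc d) 1, P x ∂((volume : Measure (Euc d)).toSphere) = 0 := by
    rw [← hcancel]
    congr 1; ext x
    have : ‖(x : Euc d)‖ = 1 := by simp
    simp [polyKernel, ha, P, this]
  have hpolar : ∫ x : Euc d, P x * (g ‖x‖ : ℂ) = 0 := by
    have hmp := (volume : Measure (Euc d)).measurePreserving_homeomorphUnitSphereProd
    have h1 : ∫ x : Euc d, P x * (g ‖x‖ : ℂ) = ∫ x : ({0}ᶜ : Set (Euc d)), P x * (g ‖(x : Euc d)‖ : ℂ)
        ∂(Measure.comap Subtype.val volume) := by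
      rw [integral_subtype_comap (measurableSet_singleton _).compl
        (fun x : Euc d => P x * (g ‖x‖ : ℂ)), restrict_compl_singleton]
    have h2 := hmp.integral_comp (homeomorphUnitSphereProd (Euc d)).measurableEmbedding
      (fun q : Metric.sphere (0 : Euc d) 1 × Set.Ioi (0 : ℝ) =>
        P q.1 * (((q.2 : ℝ) ^ 2 * g q.2 : ℝ) : ℂ))
    rw [h1]
    rw [integral_prod_mul (fun q : Metric.sphere (0 : Euc d) 1 => P q)
      (fun q : Set.Ioi (0 : ℝ) => (((q : ℝ) ^ 2 * g q : ℝ) : ℂ)), hsph, zero_mul] at h2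
    rw [← h2]
    congr 1; ext x
    have hx : ‖(x : Euc d)‖ ≠ 0 := norm_ne_zero_iff.2 x.2
    have hP : P (‖(x : Euc d)‖⁻¹ • (x : Euc d)) = (‖(x : Euc d)‖ : ℂ)⁻¹ ^ 2 * P x := by
      simp only [P, Finset.mul_sum]
      refine Finset.sum_congr rfl fun i _ => Finset.sum_congr rfl fun j _ => ?_
      simp only [PiLp.smul_apply, smul_eq_mul]
      push_cast; ring
    have hx' : (‖(x : Euc d)‖ : ℂ) ≠ 0 := by exact_mod_cast hx
    simp only [homeomorphUnitSphereProd_apply_fst_coe, homeomorphUnitSphereProd_apply_snd_coe, hP]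
    push_cast
    field_simp
  have hg : Integrable fun x : Euc d => ‖x‖ ^ 2 * g ‖x‖ := by
    have : (fun x : Euc d => ‖x‖ ^ 2 * g ‖x‖) = (Metric.ball (0 : Euc d) 1).indicator fun x => ‖x‖ ^ 2 := by
      ext x; by_cases h : ‖x‖ < 1 <;> simp [g, Set.indicator, h]
    rw [this, integrable_indicator_iff measurableSet_ball]
    exact ((Continuous.continuousOn (by fun_prop)).integrableOn_compact
      (isCompact_closedBall (0 : Euc d) 1)).mono_set Metric.ball_subset_closedBall
  have i₀ : Fin d := ⟨0, hd⟩
  rw [integral_quadratic_mul_radial a i₀ g hg] at hpolar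
  refine (mul_eq_zero.1 hpolar).resolve_right ?_
  have hpos : 0 < ∫ x : Euc d, x i₀ * x i₀ * g ‖x‖ := by
    have hnn : 0 ≤ fun x : Euc d => x i₀ * x i₀ * g ‖x‖ := by
      intro x; simp only [g]; split_ifs <;> simp [mul_self_nonneg]
    have hint : Integrable fun x : Euc d => x i₀ * x i₀ * g ‖x‖ := by
      have : (fun x : Euc d => x i₀ * x i₀ * g ‖x‖)
          = (Metric.ball (0 : Euc d) 1).indicator fun x => x i₀ * x i₀ := by
        ext x; by_cases h : ‖x‖ < 1 <;> simp [g, Set.indicator, h]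
      rw [this, integrable_indicator_iff measurableSet_ball]
      exact ((Continuous.continuousOn (by fun_prop)).integrableOn_compact
        (isCompact_closedBall (0 : Euc d) 1)).mono_set Metric.ball_subset_closedBall
    rw [integral_pos_iff_support_of_nonneg hnn hint]
    have hopen : IsOpen ({x : Euc d | x i₀ ≠ 0} ∩ Metric.ball 0 1) :=
      (isOpen_ne_fun (by fun_prop) (by fun_prop)).inter Metric.isOpen_ball
    refine (hopen.measure_pos volume ⟨EuclideanSpace.single i₀ (1/2 : ℝ), ?_, ?_⟩).trans_le
      (measure_mono ?_)
    · simp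
    · rw [mem_ball_zero_iff, PiLp.norm_single]; norm_num
    · rintro x ⟨hx, hx1⟩
      have : ‖x‖ < 1 := by simpa using hx1
      have hx' : x i₀ ≠ 0 := hx
      simp [g, this, hx']
  exact Complex.ofReal_ne_zero.2 hpos.ne'

/-! ### Cancelling kernels -/

/-- A singular integral kernel on `ℝ^d` of degree `-d`: size and Lipschitz bounds with constant `B`
away from the origin, and cancellation against every radial weight, both in the integral sense and
on the lattice `ℤ^d`. -/
structure CancellingKernel {d : ℕ} (K : Euc d → ℂ) (B : ℝ) : Prop where
  const_nonneg : 0 ≤ B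
  map_zero : K 0 = 0
  map_smul : ∀ r : ℝ, 0 < r → ∀ x, K (r • x) = ((r : ℂ) ^ d)⁻¹ * K x
  norm_le : ∀ x, ‖K x‖ ≤ B * (‖x‖ ^ d)⁻¹
  norm_sub_le : ∀ x y, x ≠ 0 → y ≠ 0 → ‖x‖ ≤ 2 * ‖y‖ → ‖y‖ ≤ 2 * ‖x‖ →
    ‖K x - K y‖ ≤ B * ‖x - y‖ * (‖x‖ ^ (d + 1))⁻¹
  integral_radial : ∀ g : ℝ → ℝ, Integrable (fun x : Euc d => (‖x‖ ^ d)⁻¹ * g ‖x‖) →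
    ∫ x, K x * (g ‖x‖ : ℂ) = 0
  tsum_radial : ∀ (g : ℝ → ℝ) (R : ℝ), (∀ r, R < r → g r = 0) →
    ∑' m : Fin d → ℤ, K (latticePoint m) * (g ‖latticePoint m‖ : ℂ) = 0

theorem latticePoint_apply {d : ℕ} (m : Fin d → ℤ) (i : Fin d) : latticePoint m i = m i := rfl

theorem latticePoint_sub {d : ℕ} (m n : Fin d → ℤ) :
    latticePoint (m - n) = latticePoint m - latticePoint n := by
  ext i; simp [latticePoint_apply]

theorem latticePoint_zero {d : ℕ} : latticePoint (0 : Fin d → ℤ) = 0 := by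
  ext i; simp [latticePoint_apply]

theorem one_le_norm_latticePoint {d : ℕ} {m : Fin d → ℤ} (hm : m ≠ 0) : 1 ≤ ‖latticePoint m‖ := by
  obtain ⟨i, hi⟩ := Function.ne_iff.1 hm
  refine le_trans ?_ (abs_coord_le_norm _ i)
  rw [latticePoint_apply]
  rw [← Int.cast_abs]
  exact_mod_cast Int.one_le_abs hi

/-- Only finitely many lattice points lie in a ball. -/
theorem finite_norm_latticePoint_le {d : ℕ} (R : ℝ) :
    {m : Fin d → ℤ | ‖latticePoint m‖ ≤ R}.Finite := by
  refine (Set.Finite.pi' (fun _ : Fin d => Set.finite_Icc (-⌈R⌉) ⌈R⌉)).subset ?_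
  intro m hm i
  have h : |(m i : ℝ)| ≤ R := (abs_coord_le_norm (latticePoint m) i).trans hm
  have h2 : |(m i : ℝ)| ≤ (⌈R⌉ : ℤ) := h.trans (Int.le_ceil R)
  have h3 : |m i| ≤ ⌈R⌉ := by exact_mod_cast h2
  exact abs_le.1 h3

theorem abs_inv_pow_sub_inv_pow_le {x y : ℝ} (hx : 0 < x) (hy : 0 < y) (hxy : x ≤ 2 * y)
    (hyx : y ≤ 2 * x) (d : ℕ) :
    |(x ^ (d + 2))⁻¹ - (y ^ (d + 2))⁻¹|
      ≤ (d + 2) * 2 ^ (2 * d + 1) * |x - y| * (x ^ (d + 1))⁻¹ * (y ^ 2)⁻¹ := by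
  have h0 : (x ^ (d + 2))⁻¹ - (y ^ (d + 2))⁻¹
      = (y ^ (d + 2) - x ^ (d + 2)) * ((x ^ (d + 2))⁻¹ * (y ^ (d + 2))⁻¹) := by
    field_simp
  have h1 := abs_pow_sub_pow_le y x (d + 2)
  have hmax : max |y| |x| ≤ 2 * x := by
    rw [abs_of_pos hx, abs_of_pos hy]; exact max_le hyx (by linarith)
  have h2 : |y ^ (d + 2) - x ^ (d + 2)| ≤ |x - y| * (d + 2) * (2 * x) ^ (d + 1) := by
    refine h1.trans ?_
    rw [abs_sub_comm y x]
    push_cast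
    gcongr
  have h3 : (y ^ d)⁻¹ ≤ 2 ^ d * (x ^ d)⁻¹ := by
    rw [← div_eq_mul_inv, le_div_iff₀ (by positivity), inv_mul_le_iff₀ (by positivity), ← mul_pow]
    gcongr
    linarith
  rw [h0, abs_mul, abs_of_pos (show 0 < (x ^ (d + 2))⁻¹ * (y ^ (d + 2))⁻¹ by positivity)]
  calc |y ^ (d + 2) - x ^ (d + 2)| * ((x ^ (d + 2))⁻¹ * (y ^ (d + 2))⁻¹)
      ≤ (|x - y| * (d + 2) * (2 * x) ^ (d + 1)) * ((x ^ (d + 2))⁻¹ * (y ^ (d + 2))⁻¹) := by gcongr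
    _ = |x - y| * (d + 2) * 2 ^ (d + 1) * x⁻¹ * (y ^ 2)⁻¹ * (y ^ d)⁻¹ := by
        field_simp; ring
    _ ≤ |x - y| * (d + 2) * 2 ^ (d + 1) * x⁻¹ * (y ^ 2)⁻¹ * (2 ^ d * (x ^ d)⁻¹) := by gcongr
    _ = _ := by field_simp; ring

/-- A trace-zero quadratic form over `|x|^{d+2}` is a cancelling kernel. -/
theorem polyKernel_cancellingKernel {d : ℕ} (hd : 1 ≤ d) {p : MvPolynomial (Fin d) ℂ}
    (hp : p.IsHomogeneous 2) (hcancel : SphericalCancellation (polyKernel p)) :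
    ∃ B, CancellingKernel (polyKernel p) B := by
  obtain ⟨a, ha⟩ := hp.exists_quadratic
  have htr := trace_eq_zero_of_sphericalCancellation hd ha hcancel
  let i₀ : Fin d := ⟨0, hd⟩
  let P : Euc d → ℂ := fun x => ∑ i, ∑ j, a i j * ((x i : ℂ) * (x j : ℂ))
  let A : ℝ := ∑ i, ∑ j, ‖a i j‖
  have hA : 0 ≤ A := Finset.sum_nonneg fun i _ => Finset.sum_nonneg fun j _ => norm_nonneg _
  have hK : ∀ x, polyKernel p x = P x / (‖x‖ : ℂ) ^ (d + 2) := by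
    intro x; rw [polyKernel, ha]
  have hPle : ∀ x, ‖P x‖ ≤ A * ‖x‖ ^ 2 := by
    intro x
    simp only [P, A, Finset.sum_mul]
    refine (norm_sum_le _ _).trans (Finset.sum_le_sum fun i _ => ?_)
    refine (norm_sum_le _ _).trans (Finset.sum_le_sum fun j _ => ?_)
    rw [norm_mul, norm_mul, Complex.norm_real, Complex.norm_real, pow_two]
    gcongr
    · exact abs_coord_le_norm x i
    · exact abs_coord_le_norm x j
  have hPsub : ∀ x y, ‖P x - P y‖ ≤ A * (‖x - y‖ * (‖x‖ + ‖y‖)) := by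
    intro x y
    simp only [P, A, Finset.sum_mul, ← Finset.sum_sub_distrib]
    refine (norm_sum_le _ _).trans (Finset.sum_le_sum fun i _ => ?_)
    refine (norm_sum_le _ _).trans (Finset.sum_le_sum fun j _ => ?_)
    rw [← mul_sub, norm_mul]
    gcongr
    have h : (x i : ℂ) * (x j : ℂ) - (y i : ℂ) * (y j : ℂ)
        = ((x i * (x - y) j + (x - y) i * y j : ℝ) : ℂ) := by
      simp only [PiLp.sub_apply]; push_cast; ring
    rw [h, Complex.norm_real, Real.norm_eq_abs]
    refine (abs_add_le _ _).trans ?_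
    rw [abs_mul, abs_mul, mul_add, mul_comm |x i|]
    gcongr
    · exact abs_coord_le_norm (x - y) j
    · exact abs_coord_le_norm x i
    · exact abs_coord_le_norm (x - y) i
    · exact abs_coord_le_norm y j
  let D : ℝ := (d + 2) * 2 ^ (2 * d + 1)
  have hD : 0 ≤ D := by positivity
  refine ⟨A * (3 + D), ?_, ?_, ?_, ?_, ?_, ?_, ?_⟩
  · positivity
  · rw [hK]; simp
  · intro r hr x
    have hPr : P (r • x) = (r : ℂ) ^ 2 * P x := by
      simp only [P, Finset.mul_sum]
      refine Finset.sum_congr rfl fun i _ => Finset.sum_congr rfl fun j _ => ?_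
      simp only [PiLp.smul_apply, smul_eq_mul]
      push_cast; ring
    rw [hK, hK, hPr, norm_smul, Real.norm_of_nonneg hr.le]
    have hr' : (r : ℂ) ≠ 0 := by exact_mod_cast hr.ne'
    push_cast
    rw [mul_pow, div_eq_mul_inv, div_eq_mul_inv, mul_inv, pow_add]
    field_simp
  · intro x
    rcases eq_or_ne x 0 with rfl | hx
    · rw [hK]
      simp only [norm_zero, Complex.ofReal_zero]
      rw [zero_pow (by omega), div_zero, norm_zero]
      positivity
    have hx' : 0 < ‖x‖ := norm_pos_iff.2 hx
    rw [hK, norm_div, norm_pow, Complex.norm_real, norm_norm, div_le_iff₀ (by positivity)]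
    calc ‖P x‖ ≤ A * ‖x‖ ^ 2 := hPle x
      _ = A * 1 * (‖x‖ ^ d)⁻¹ * ‖x‖ ^ (d + 2) := by field_simp; ring
      _ ≤ _ := by gcongr; linarith
  · intro x y hx hy hxy hyx
    have hx' : 0 < ‖x‖ := norm_pos_iff.2 hx
    have hy' : 0 < ‖y‖ := norm_pos_iff.2 hy
    have hsplit : polyKernel p x - polyKernel p y
        = (P x - P y) * ((‖x‖ ^ (d + 2))⁻¹ : ℝ)
          + P y * (((‖x‖ ^ (d + 2))⁻¹ - (‖y‖ ^ (d + 2))⁻¹ : ℝ) : ℂ) := by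
      rw [hK, hK]; push_cast; ring
    rw [hsplit]
    refine (norm_add_le _ _).trans ?_
    rw [norm_mul, norm_mul, Complex.norm_real, Complex.norm_real, Real.norm_eq_abs,
      Real.norm_eq_abs, abs_of_pos (by positivity : 0 < (‖x‖ ^ (d + 2))⁻¹)]
    have e1 : ‖P x - P y‖ * (‖x‖ ^ (d + 2))⁻¹ ≤ 3 * A * ‖x - y‖ * (‖x‖ ^ (d + 1))⁻¹ := by
      calc ‖P x - P y‖ * (‖x‖ ^ (d + 2))⁻¹
          ≤ A * (‖x - y‖ * (‖x‖ + 2 * ‖x‖)) * (‖x‖ ^ (d + 2))⁻¹ := by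
            gcongr; exact (hPsub x y).trans (by gcongr)
        _ = _ := by field_simp; ring
    have e2 : ‖P y‖ * |(‖x‖ ^ (d + 2))⁻¹ - (‖y‖ ^ (d + 2))⁻¹|
        ≤ A * D * ‖x - y‖ * (‖x‖ ^ (d + 1))⁻¹ := by
      calc _ ≤ (A * ‖y‖ ^ 2) * (D * ‖x - y‖ * (‖x‖ ^ (d + 1))⁻¹ * (‖y‖ ^ 2)⁻¹) := by
            gcongr
            · exact hPle y
            · refine (abs_inv_pow_sub_inv_pow_le hx' hy' hxy hyx d).trans ?_
              gcongr
              exact abs_norm_sub_norm_le x y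
        _ = _ := by field_simp
    calc _ ≤ _ := add_le_add e1 e2
      _ = _ := by ring
  · intro g hg
    have h := integral_quadratic_mul_radial a i₀ (fun r => (r ^ (d + 2))⁻¹ * g r) (by
      refine hg.congr (Eventually.of_forall fun x => ?_)
      rcases eq_or_ne x 0 with rfl | hx
      · simp only [norm_zero]
        rw [zero_pow (by omega)]; simp
      have hx' : ‖x‖ ≠ 0 := norm_ne_zero_iff.2 hx
      simp only
      field_simp
      ring)
    rw [htr, zero_mul] at h
    rw [← h]
    congr 1; ext x
    rw [hK]; push_cast; ring
  · intro g R hg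
    let G : ℝ → ℝ := fun r => (r ^ (d + 2))⁻¹ * g r
    have hsupp : ∀ m : Fin d → ℤ, m ∉ (finite_norm_latticePoint_le (d := d) R).toFinset →
        G ‖latticePoint m‖ = 0 := by
      intro m hm
      simp only [Set.Finite.mem_toFinset, Set.mem_ofPred_eq, not_le] at hm
      simp [G, hg _ hm]
    set S := (finite_norm_latticePoint_le (d := d) R).toFinset
    have hc : ∀ i j, ∑' m : Fin d → ℤ, (m i : ℝ) * m j * G ‖latticePoint m‖
        = ∑ m ∈ S, (m i : ℝ) * m j * G ‖latticePoint m‖ := fun i j =>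
      tsum_eq_sum fun m hm => by rw [hsupp m hm, mul_zero]
    have h := sum_mul_eq_trace_mul a
      (fun i j => ∑' m : Fin d → ℤ, (m i : ℝ) * m j * G ‖latticePoint m‖) i₀
      (fun i j hij => tsum_lattice_mul_radial_of_ne hij G)
      (fun i j => tsum_lattice_sq_mul_radial i j G)
    rw [htr, zero_mul] at h
    rw [tsum_eq_sum (s := S), ← h]
    · simp only [hc, Complex.ofReal_sum, Finset.mul_sum]
      have : ∀ i, ∑ j, ∑ m ∈ S, a i j * (((m i : ℝ) * m j * G ‖latticePoint m‖ : ℝ) : ℂ)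
        = ∑ m ∈ S, ∑ j, a i j * (((m i : ℝ) * m j * G ‖latticePoint m‖ : ℝ) : ℂ) :=
        fun i => Finset.sum_comm
      simp only [this]
      rw [Finset.sum_comm]
      refine Finset.sum_congr rfl fun m _ => ?_
      rw [hK]
      simp only [P, G, latticePoint_apply, Finset.sum_div, Finset.sum_mul]
      refine Finset.sum_congr rfl fun i _ => Finset.sum_congr rfl fun j _ => ?_
      push_cast; ring
    · intro m hm
      simp only [S, Set.Finite.mem_toFinset, Set.mem_ofPred_eq, not_le] at hm
      simp [hg _ hm]

/-! ### Lattice cells and Riemann sums -/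

/-- The point `k / N` of the rescaled lattice. -/
noncomputable def scaledPoint {d : ℕ} (N : ℕ) (k : Fin d → ℤ) : Euc d :=
  (N : ℝ)⁻¹ • latticePoint k

/-- The index of the point of `N⁻¹ ℤ^d` nearest to `x`. -/
noncomputable def nearestIndex {d : ℕ} (N : ℕ) (x : Euc d) : Fin d → ℤ :=
  fun i => round ((N : ℝ) * x i)

/-- The cell of side `1 / N` around `k / N`. -/
def latticeCell {d : ℕ} (N : ℕ) (k : Fin d → ℤ) : Set (Euc d) := nearestIndex N ⁻¹' {k}

theorem mem_latticeCell {d N : ℕ} {k : Fin d → ℤ} {x : Euc d} :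
    x ∈ latticeCell N k ↔ nearestIndex N x = k := Iff.rfl

theorem scaledPoint_zero {d N : ℕ} : scaledPoint N (0 : Fin d → ℤ) = 0 := by
  rw [scaledPoint, latticePoint_zero, smul_zero]

theorem scaledPoint_apply {d N : ℕ} (k : Fin d → ℤ) (i : Fin d) :
    scaledPoint N k i = (N : ℝ)⁻¹ * k i := rfl

theorem norm_scaledPoint {d N : ℕ} (k : Fin d → ℤ) :
    ‖scaledPoint N k‖ = (N : ℝ)⁻¹ * ‖latticePoint k‖ := by
  rw [scaledPoint, norm_smul, Real.norm_of_nonneg (by positivity)]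

theorem measurable_nearestIndex {d N : ℕ} : Measurable (nearestIndex N : Euc d → Fin d → ℤ) := by
  refine measurable_pi_lambda _ fun i => ?_
  have h : Measurable fun x : Euc d => (N : ℝ) * x i + 1 / 2 := by fun_prop
  simp only [nearestIndex, round_eq]
  exact Int.measurable_floor.comp h

theorem measurableSet_latticeCell {d N : ℕ} (k : Fin d → ℤ) :
    MeasurableSet (latticeCell N k) :=
  measurable_nearestIndex (measurableSet_singleton k)

theorem iUnion_latticeCell {d N : ℕ} : ⋃ k : Fin d → ℤ, latticeCell N k = Set.univ := by
  ext x; simp [mem_latticeCell]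

theorem pairwise_disjoint_latticeCell {d N : ℕ} :
    Pairwise (Function.onFun Disjoint (latticeCell N : (Fin d → ℤ) → Set (Euc d))) := by
  intro k l hkl
  exact Set.disjoint_left.2 fun x hk hl => hkl (hk.symm.trans hl)

theorem nearestIndex_add {d N : ℕ} (hN : 1 ≤ N) (k : Fin d → ℤ) (x : Euc d) :
    nearestIndex N (scaledPoint N k + x) = k + nearestIndex N x := by
  ext i
  have hN' : (N : ℝ) ≠ 0 := by positivity
  have : (N : ℝ) * (scaledPoint N k + x) i = (k i : ℝ) + N * x i := by
    rw [PiLp.add_apply, scaledPoint_apply]; field_simp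
  simp only [nearestIndex, this, Pi.add_apply, round_intCast_add]

theorem preimage_add_latticeCell {d N : ℕ} (hN : 1 ≤ N) (k : Fin d → ℤ) :
    (fun x : Euc d => scaledPoint N k + x) ⁻¹' latticeCell N k = latticeCell N 0 := by
  ext x
  simp [mem_latticeCell, nearestIndex_add hN]

theorem hasSum_integral_latticeCell {d N : ℕ} {F : Type*} [NormedAddCommGroup F]
    [NormedSpace ℝ F] {f : Euc d → F} (hf : Integrable f) :
    HasSum (fun k : Fin d → ℤ => ∫ x in latticeCell N k, f x) (∫ x, f x) := by
  have h := hasSum_integral_iUnion (f := f) (μ := volume) (s := latticeCell (d := d) N)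
    measurableSet_latticeCell pairwise_disjoint_latticeCell hf.integrableOn
  rwa [iUnion_latticeCell, setIntegral_univ] at h

theorem setIntegral_latticeCell {d N : ℕ} (hN : 1 ≤ N) {F : Type*} [NormedAddCommGroup F]
    [NormedSpace ℝ F] (f : Euc d → F) (k : Fin d → ℤ) :
    ∫ x in latticeCell N k, f x = ∫ x in latticeCell N 0, f (scaledPoint N k + x) := by
  rw [← preimage_add_latticeCell hN k]
  exact ((measurePreserving_add_left volume (scaledPoint N k)).setIntegral_preimage_emb
    (measurableEmbedding_addLeft _) f _).symm

/-- Unfolding of an integral over `ℝ^d` into the cells of `N⁻¹ ℤ^d`. -/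
theorem lintegral_eq_lintegral_tsum {d N : ℕ} (hN : 1 ≤ N) {f : Euc d → ℝ≥0∞}
    (hf : Measurable f) :
    ∫⁻ x, f x = ∫⁻ x in latticeCell N 0, ∑' k : Fin d → ℤ, f (scaledPoint N k + x) := by
  rw [lintegral_tsum (f := fun k x => f (scaledPoint N k + x))
    fun k => (hf.comp (measurable_const_add _)).aemeasurable]
  have h := lintegral_iUnion (μ := volume) (s := latticeCell (d := d) N) measurableSet_latticeCell
    pairwise_disjoint_latticeCell f
  rw [iUnion_latticeCell, setLIntegral_univ] at h
  rw [h]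
  congr 1; ext k
  rw [← preimage_add_latticeCell hN k]
  exact ((measurePreserving_add_left volume (scaledPoint N k)).setLIntegral_comp_preimage_emb
    (measurableEmbedding_addLeft _) f _).symm

/-- A function whose sums over all shifts of the lattice are nonnegative has a nonnegative
integral. -/
theorem integral_nonneg_of_tsum_nonneg {d N : ℕ} (hN : 1 ≤ N) {f : Euc d → ℝ}
    (hf : Integrable f) (h : ∀ x, 0 ≤ ∑' k : Fin d → ℤ, f (scaledPoint N k + x)) :
    0 ≤ ∫ x, f x := by
  have h1 : ∀ k : Fin d → ℤ, Integrable (fun x => f (scaledPoint N k + x))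
      (volume.restrict (latticeCell N 0)) := fun k =>
    (hf.comp_add_left (scaledPoint N k)).integrableOn
  have h2 := hasSum_integral_latticeCell (N := N) hf.norm
  simp only [setIntegral_latticeCell hN (fun x => ‖f x‖)] at h2
  have h3 := hasSum_integral_of_summable_integral_norm h1 h2.summable
  have h4 := hasSum_integral_latticeCell (N := N) hf
  simp only [setIntegral_latticeCell hN f] at h4
  rw [h4.unique h3]
  exact integral_nonneg h

theorem volume_latticeCell {d N : ℕ} (hN : 1 ≤ N) (k : Fin d → ℤ) :
    volume.real (latticeCell N k : Set (Euc d)) = ((N : ℝ) ^ d)⁻¹ := by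
  have hN' : (0 : ℝ) < N := by positivity
  have hset : latticeCell N k = (MeasurableEquiv.toLp 2 (Fin d → ℝ)).symm ⁻¹'
      (Set.univ.pi fun i => Set.Ico (((k i : ℝ) - 1 / 2) / N) (((k i : ℝ) + 1 / 2) / N)) := by
    ext x
    simp only [mem_latticeCell, Set.mem_preimage, Set.mem_pi, Set.mem_univ, true_implies,
      funext_iff, nearestIndex, round_eq, Int.floor_eq_iff, Set.mem_Ico,
      div_le_iff₀ hN', lt_div_iff₀ hN']
    refine forall_congr' fun i => ?_
    have : (MeasurableEquiv.toLp 2 (Fin d → ℝ)).symm x i = x i := rfl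
    rw [this]
    constructor <;> rintro ⟨h1, h2⟩ <;> constructor <;> linarith
  rw [measureReal_def, hset, (EuclideanSpace.volume_preserving_symm_measurableEquiv_toLp
    (Fin d)).measure_preimage_equiv, Real.volume_pi_Ico]
  have : ∀ i, ((k i : ℝ) + 1 / 2) / N - ((k i : ℝ) - 1 / 2) / N = (N : ℝ)⁻¹ := by
    intro i; field_simp; ring
  simp only [this, Finset.prod_const, Finset.card_univ, Fintype.card_fin]
  rw [ENNReal.toReal_pow, ENNReal.toReal_ofReal (by positivity), inv_pow]

theorem abs_sub_scaledPoint_nearestIndex_le {d N : ℕ} (hN : 1 ≤ N) (x : Euc d) (i : Fin d) :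
    |x i - scaledPoint N (nearestIndex N x) i| ≤ (2 * (N : ℝ))⁻¹ := by
  have hN' : (0 : ℝ) < N := by positivity
  have h := abs_sub_round ((N : ℝ) * x i)
  have e : x i - scaledPoint N (nearestIndex N x) i
      = (N : ℝ)⁻¹ * (N * x i - round ((N : ℝ) * x i)) := by
    rw [scaledPoint_apply, nearestIndex]; field_simp
  rw [e, abs_mul, abs_of_pos (by positivity), mul_inv, mul_comm (2 : ℝ)⁻¹]
  gcongr
  linarith

theorem norm_sub_scaledPoint_nearestIndex_le {d N : ℕ} (hN : 1 ≤ N) (x : Euc d) :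
    ‖x - scaledPoint N (nearestIndex N x)‖ ≤ d * (2 * (N : ℝ))⁻¹ := by
  rw [EuclideanSpace.norm_eq]
  refine Real.sqrt_le_iff.2 ⟨by positivity, ?_⟩
  calc ∑ i, ‖(x - scaledPoint N (nearestIndex N x)) i‖ ^ 2
      ≤ ∑ i : Fin d, ((2 * (N : ℝ))⁻¹) ^ 2 := by
        gcongr with i
        exact abs_sub_scaledPoint_nearestIndex_le hN x i
    _ = d * ((2 * (N : ℝ))⁻¹) ^ 2 := by simp
    _ ≤ (d * (2 * (N : ℝ))⁻¹) ^ 2 := by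
        rw [mul_pow]
        gcongr
        rcases Nat.eq_zero_or_pos d with h | h
        · simp [h]
        · have : (1 : ℝ) ≤ d := by exact_mod_cast h
          nlinarith

theorem norm_scaledPoint_nearestIndex_le {d N : ℕ} (hN : 1 ≤ N) (x : Euc d) :
    ‖scaledPoint N (nearestIndex N x)‖ ≤ 2 * ‖x‖ := by
  have hN' : (0 : ℝ) < N := by positivity
  have h2 : 2 * ‖x‖ = ‖(2 : ℝ) • x‖ := by rw [norm_smul]; norm_num
  rw [h2, EuclideanSpace.norm_eq, EuclideanSpace.norm_eq]
  gcongr with i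
  rw [PiLp.smul_apply, norm_smul, Real.norm_eq_abs, Real.norm_eq_abs]
  have h := abs_sub_scaledPoint_nearestIndex_le hN x i
  rcases eq_or_ne (nearestIndex N x i) 0 with h0 | h0
  · rw [scaledPoint_apply, h0]; simp
  · have h1 : (N : ℝ)⁻¹ ≤ |scaledPoint N (nearestIndex N x) i| := by
      rw [scaledPoint_apply, abs_mul, abs_of_pos (inv_pos.2 hN')]
      have : (1 : ℝ) ≤ |(nearestIndex N x i : ℝ)| := by
        rw [← Int.cast_abs]; exact_mod_cast Int.one_le_abs h0
      exact le_mul_of_one_le_right (by positivity) this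
    have h3 := abs_sub_abs_le_abs_sub (scaledPoint N (nearestIndex N x) i) (x i)
    rw [abs_sub_comm] at h3
    rw [mul_inv] at h
    rw [Real.norm_eq_abs, abs_two]
    linarith

theorem norm_le_norm_scaledPoint_nearestIndex {d N : ℕ} [NeZero d] (hN : 1 ≤ N) {x : Euc d}
    (hx : nearestIndex N x ≠ 0) : ‖x‖ ≤ 2 * d * ‖scaledPoint N (nearestIndex N x)‖ := by
  have hN' : (0 : ℝ) < N := by positivity
  have hd : (1 : ℝ) ≤ d := by exact_mod_cast NeZero.one_le
  have h1 : (N : ℝ)⁻¹ ≤ ‖scaledPoint N (nearestIndex N x)‖ := by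
    rw [norm_scaledPoint]
    exact le_mul_of_one_le_right (by positivity) (one_le_norm_latticePoint hx)
  have h2 := norm_sub_scaledPoint_nearestIndex_le hN x
  have h3 := norm_sub_norm_le x (scaledPoint N (nearestIndex N x))
  rw [mul_inv] at h2
  have h4 : (d : ℝ) * (2⁻¹ * (N : ℝ)⁻¹) ≤ d * (2⁻¹ * ‖scaledPoint N (nearestIndex N x)‖) := by
    gcongr
  nlinarith [norm_nonneg (scaledPoint N (nearestIndex N x))]

/-- The radial majorant `min(r, r⁻¹) r^{-d}`, integrable on `ℝ^d` both at the origin and at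
infinity. -/
noncomputable def radialMajorant (d : ℕ) (r : ℝ) : ℝ := min r r⁻¹ * (r ^ d)⁻¹

theorem radialMajorant_nonneg {d : ℕ} {r : ℝ} (hr : 0 ≤ r) : 0 ≤ radialMajorant d r := by
  unfold radialMajorant; positivity

theorem radialMajorant_zero {d : ℕ} : radialMajorant d 0 = 0 := by simp [radialMajorant]

theorem radialMajorant_le {d : ℕ} {r s c : ℝ} (hr : 0 < r) (hs : 0 < s) (hc : 0 < c)
    (hrs : r ≤ c * s) (hsr : s ≤ c * r) :
    radialMajorant d r ≤ c ^ (d + 1) * radialMajorant d s := by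
  have h1 : min r r⁻¹ ≤ c * min s s⁻¹ := by
    rw [mul_min_of_nonneg _ _ hc.le]
    refine min_le_min hrs ?_
    rw [← div_eq_mul_inv, le_div_iff₀ hs, inv_mul_le_iff₀ hr]
    linarith
  have h2 : (r ^ d)⁻¹ ≤ c ^ d * (s ^ d)⁻¹ := by
    rw [← div_eq_mul_inv, le_div_iff₀ (by positivity), inv_mul_le_iff₀ (by positivity), ← mul_pow]
    gcongr
    linarith
  calc radialMajorant d r ≤ (c * min s s⁻¹) * (c ^ d * (s ^ d)⁻¹) := by
        unfold radialMajorant; gcongr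
    _ = _ := by unfold radialMajorant; ring

theorem mul_inv_pow_le_radialMajorant {d : ℕ} {r R : ℝ} (hr : 0 ≤ r) (hR : 1 ≤ R) (hrR : r ≤ R) :
    r * (r ^ d)⁻¹ ≤ R ^ 2 * radialMajorant d r := by
  unfold radialMajorant
  rw [← mul_assoc]
  gcongr
  rcases hr.eq_or_lt with rfl | hr
  · simp
  rw [mul_min_of_nonneg _ _ (by positivity)]
  refine le_min (le_mul_of_one_le_left hr.le (by nlinarith)) ?_
  rw [← div_eq_mul_inv, le_div_iff₀ hr]
  nlinarith

theorem inv_mul_inv_pow_le_radialMajorant {d : ℕ} {r c : ℝ} (hc : 0 < c) (hc1 : c ≤ 1)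
    (hrc : c ≤ r) : r⁻¹ * (r ^ d)⁻¹ ≤ (c ^ 2)⁻¹ * radialMajorant d r := by
  have hr : 0 < r := hc.trans_le hrc
  unfold radialMajorant
  rw [← mul_assoc]
  gcongr
  rw [mul_min_of_nonneg _ _ (by positivity)]
  refine le_min ?_ ?_
  · rw [le_inv_mul_iff₀ (by positivity), ← div_eq_mul_inv, div_le_iff₀ hr]
    nlinarith
  · exact le_mul_of_one_le_left (by positivity) (one_le_inv_iff₀.2 ⟨by positivity, by nlinarith⟩)

theorem integrable_radialMajorant {d : ℕ} [NeZero d] :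
    Integrable fun x : Euc d => radialMajorant d ‖x‖ := by
  rw [integrable_fun_norm_addHaar (volume : Measure (Euc d)) (f := radialMajorant d)]
  have hfr : Module.finrank ℝ (Euc d) = d := by simp
  rw [hfr, ← Set.Ioc_union_Ioi_eq_Ioi (zero_le_one' ℝ)]
  have hd : d = (d - 1) + 1 := (Nat.sub_add_cancel NeZero.one_le).symm
  have key : ∀ y : ℝ, 0 < y → y ^ (d - 1) * radialMajorant d y = min y y⁻¹ * y⁻¹ := by
    intro y hy
    unfold radialMajorant
    conv_lhs => rw [hd]
    simp only [Nat.add_sub_cancel]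
    rw [pow_succ]
    field_simp
  refine IntegrableOn.union ?_ ?_
  · refine (integrableOn_const (C := (1 : ℝ)) (by simp)).congr_fun ?_ measurableSet_Ioc
    intro y hy
    have hy0 : 0 < y := hy.1
    simp only [smul_eq_mul, key y hy0]
    rw [min_eq_left (hy.2.trans (one_le_inv_iff₀.2 ⟨hy0, hy.2⟩)), mul_inv_cancel₀ hy0.ne']
  · refine (integrableOn_Ioi_rpow_of_lt (show (-2 : ℝ) < -1 by norm_num) one_pos).congr_fun ?_
      measurableSet_Ioi
    intro y hy
    have hy1 : 1 < y := hy
    have hy0 : 0 < y := by linarith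
    simp only [smul_eq_mul, key y hy0]
    rw [min_eq_right ((inv_le_one_of_one_le₀ hy1.le).trans hy1.le), Real.rpow_neg hy0.le]
    norm_cast
    rw [← mul_inv, pow_two]

/-- Uniform bound for the Riemann sums of the radial majorant. -/
theorem exists_tsum_radialMajorant_le (d : ℕ) [NeZero d] :
    ∃ C : ℝ, 0 ≤ C ∧ ∀ N : ℕ, 1 ≤ N →
      Summable (fun k : Fin d → ℤ => ((N : ℝ) ^ d)⁻¹ * radialMajorant d ‖scaledPoint N k‖) ∧
      ∑' k : Fin d → ℤ, ((N : ℝ) ^ d)⁻¹ * radialMajorant d ‖scaledPoint N k‖ ≤ C := by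
  have hd : (1 : ℝ) ≤ d := by exact_mod_cast NeZero.one_le
  refine ⟨(2 * d) ^ (d + 1) * ∫ x : Euc d, radialMajorant d ‖x‖, ?_, fun N hN => ?_⟩
  · exact mul_nonneg (by positivity)
      (integral_nonneg fun x => radialMajorant_nonneg (norm_nonneg _))
  have hint := (integrable_radialMajorant (d := d)).const_mul ((2 * d : ℝ) ^ (d + 1))
  have hs := hasSum_integral_latticeCell (N := N) hint
  have hle : ∀ k : Fin d → ℤ, ((N : ℝ) ^ d)⁻¹ * radialMajorant d ‖scaledPoint N k‖
      ≤ ∫ x in latticeCell N k, (2 * d : ℝ) ^ (d + 1) * radialMajorant d ‖x‖ := by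
    intro k
    rcases eq_or_ne k 0 with rfl | hk
    · rw [scaledPoint_zero, norm_zero, radialMajorant_zero, mul_zero]
      exact integral_nonneg fun x =>
        mul_nonneg (by positivity) (radialMajorant_nonneg (norm_nonneg _))
    rw [← volume_latticeCell hN k, ← smul_eq_mul, ← setIntegral_const]
    refine setIntegral_mono_on ?_ hint.integrableOn (measurableSet_latticeCell k) ?_
    · refine integrableOn_const ?_
      intro h
      have h1 := volume_latticeCell hN k
      rw [measureReal_def, h, ENNReal.toReal_top] at h1
      have : (0 : ℝ) < ((N : ℝ) ^ d)⁻¹ := by positivity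
      linarith
    · intro x hx
      rw [mem_latticeCell] at hx
      subst hx
      have h1 := norm_scaledPoint_nearestIndex_le hN x
      have h2 := norm_le_norm_scaledPoint_nearestIndex hN hk
      have h3 : 0 < ‖scaledPoint N (nearestIndex N x)‖ := by
        rw [norm_scaledPoint]
        have := one_le_norm_latticePoint hk
        positivity
      have h4 : 0 < ‖x‖ := by linarith
      refine radialMajorant_le h3 h4 (by positivity) (h1.trans ?_) h2
      nlinarith
  have hnn : ∀ k : Fin d → ℤ, 0 ≤ ((N : ℝ) ^ d)⁻¹ * radialMajorant d ‖scaledPoint N k‖ :=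
    fun k => mul_nonneg (by positivity) (radialMajorant_nonneg (norm_nonneg _))
  have hsum := Summable.of_nonneg_of_le hnn hle hs.summable
  refine ⟨hsum, (hsum.tsum_le_tsum hle hs.summable).trans ?_⟩
  rw [hs.tsum_eq, integral_const_mul]

/-- Riemann sums over `N⁻¹ ℤ^d` converge for functions with a singularity at the origin that are
dominated by the radial majorant. -/
theorem tendsto_riemannSum {d : ℕ} [NeZero d] {G : Euc d → ℂ} {A : ℝ} (hA : 0 ≤ A)
    (hcont : ∀ z, z ≠ 0 → ContinuousAt G z) (hG : ∀ z, ‖G z‖ ≤ A * radialMajorant d ‖z‖) :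
    Tendsto (fun N : ℕ => ∑' k : Fin d → ℤ, ((N : ℂ) ^ d)⁻¹ * G (scaledPoint N k)) atTop
      (𝓝 (∫ z, G z)) := by
  have hd : (1 : ℝ) ≤ d := by exact_mod_cast NeZero.one_le
  have hG0 : G 0 = 0 := by
    have := hG 0
    rw [norm_zero, radialMajorant_zero, mul_zero] at this
    exact norm_le_zero_iff.1 this
  have hbd : ∀ N : ℕ, 1 ≤ N → ∀ x : Euc d, ‖G (scaledPoint N (nearestIndex N x))‖
      ≤ A * (2 * d) ^ (d + 1) * radialMajorant d ‖x‖ := by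
    intro N hN x
    rcases eq_or_ne (nearestIndex N x) 0 with h0 | h0
    · rw [h0, scaledPoint_zero, hG0, norm_zero]
      exact mul_nonneg (by positivity) (radialMajorant_nonneg (norm_nonneg _))
    have h1 := norm_scaledPoint_nearestIndex_le hN x
    have h2 := norm_le_norm_scaledPoint_nearestIndex hN h0
    have h3 : 0 < ‖scaledPoint N (nearestIndex N x)‖ := by
      rw [norm_scaledPoint]
      have := one_le_norm_latticePoint h0
      positivity
    have h4 : 0 < ‖x‖ := by linarith
    refine (hG _).trans ?_
    rw [mul_assoc]
    gcongr
    exact radialMajorant_le h3 h4 (by positivity) (h1.trans (by nlinarith)) h2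
  have hmeas : ∀ N : ℕ, Measurable fun x : Euc d => G (scaledPoint N (nearestIndex N x)) :=
    fun N => (measurable_of_countable fun k : Fin d → ℤ => G (scaledPoint N k)).comp
      measurable_nearestIndex
  have hdom := (integrable_radialMajorant (d := d)).const_mul (A * (2 * d) ^ (d + 1))
  have heq : ∀ N : ℕ, 1 ≤ N → ∫ x : Euc d, G (scaledPoint N (nearestIndex N x))
      = ∑' k : Fin d → ℤ, ((N : ℂ) ^ d)⁻¹ * G (scaledPoint N k) := by
    intro N hN
    have hint : Integrable fun x : Euc d => G (scaledPoint N (nearestIndex N x)) :=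
      hdom.mono' (hmeas N).aestronglyMeasurable (Eventually.of_forall (hbd N hN))
    rw [← (hasSum_integral_latticeCell (N := N) hint).tsum_eq]
    congr 1; ext k
    rw [setIntegral_congr_fun (measurableSet_latticeCell k)
      (g := fun _ => G (scaledPoint N k)) (fun x hx => by rw [mem_latticeCell.1 hx]),
      setIntegral_const, volume_latticeCell hN k, Complex.real_smul]
    push_cast; rfl
  have hlim : Tendsto (fun N : ℕ => ∫ x : Euc d, G (scaledPoint N (nearestIndex N x))) atTop
      (𝓝 (∫ z, G z)) := by
    refine tendsto_integral_filter_of_dominated_convergence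
      (fun x => A * (2 * d) ^ (d + 1) * radialMajorant d ‖x‖)
      (Eventually.of_forall fun N => (hmeas N).aestronglyMeasurable)
      ((eventually_ge_atTop 1).mono fun N hN => Eventually.of_forall (hbd N hN)) hdom ?_
    filter_upwards [(measure_eq_zero_iff_ae_notMem (s := {(0 : Euc d)})).1 (measure_singleton 0)]
      with x hx
    refine (hcont x hx).tendsto.comp ?_
    rw [tendsto_iff_norm_sub_tendsto_zero]
    have h0 : Tendsto (fun N : ℕ => (d : ℝ) * (2 * (N : ℝ))⁻¹) atTop (𝓝 0) := by
      have := (tendsto_natCast_atTop_atTop (R := ℝ)).const_mul_atTop (show (0 : ℝ) < 2 by norm_num)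
      simpa using (tendsto_inv_atTop_zero.comp this).const_mul (d : ℝ)
    refine squeeze_zero' (Eventually.of_forall fun _ => norm_nonneg _) ?_ h0
    filter_upwards [eventually_ge_atTop 1] with N hN
    rw [norm_sub_rev]
    exact norm_sub_scaledPoint_nearestIndex_le hN x
  refine hlim.congr' ?_
  filter_upwards [eventually_ge_atTop 1] with N hN using heq N hN

/-! ### Truncation of the kernel on the lattice -/

/-- The Lipschitz cutoff equal to `1` on `[0, 1]` and to `0` on `[2, ∞)`. -/
noncomputable def cutoff (r : ℝ) : ℝ := max 0 (min 1 (2 - r))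

theorem cutoff_nonneg (r : ℝ) : 0 ≤ cutoff r := le_max_left _ _

theorem cutoff_le_one (r : ℝ) : cutoff r ≤ 1 := max_le zero_le_one (min_le_left _ _)

theorem cutoff_of_le_one {r : ℝ} (hr : r ≤ 1) : cutoff r = 1 := by
  rw [cutoff, min_eq_left (by linarith), max_eq_right zero_le_one]

theorem cutoff_of_two_le {r : ℝ} (hr : 2 ≤ r) : cutoff r = 0 := by
  rw [cutoff, max_eq_left]
  exact (min_le_right _ _).trans (by linarith)

theorem abs_cutoff_sub_le (r s : ℝ) : |cutoff r - cutoff s| ≤ |r - s| := by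
  unfold cutoff
  refine (abs_max_sub_max_le_max _ _ _ _).trans ?_
  rw [sub_self, abs_zero]
  refine max_le (abs_nonneg _) ((abs_min_sub_min_le_max _ _ _ _).trans ?_)
  rw [sub_self, abs_zero]
  refine max_le (abs_nonneg _) ?_
  rw [abs_sub_comm r s]
  refine le_of_eq ?_
  congr 1; ring

theorem continuous_cutoff : Continuous cutoff := by unfold cutoff; fun_prop

/-- The part of the lattice kernel near the origin, at scale `N`. -/
noncomputable def nearKernel {d : ℕ} (K : Euc d → ℂ) (N : ℕ) (k : Fin d → ℤ) : ℂ :=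
  (cutoff ‖scaledPoint N k‖ : ℂ) * K (latticePoint k)

/-- The lattice sum of the near part vanishes, since the cutoff is a radial weight. -/
theorem CancellingKernel.tsum_nearKernel {d : ℕ} {K : Euc d → ℂ} {B : ℝ}
    (hK : CancellingKernel K B) {N : ℕ} (hN : 1 ≤ N) : ∑' k, nearKernel K N k = 0 := by
  have hN' : (0 : ℝ) < N := by positivity
  have h := hK.tsum_radial (fun r => cutoff ((N : ℝ)⁻¹ * r)) (2 * N) (by
    intro r hr
    refine cutoff_of_two_le ?_
    rw [le_inv_mul_iff₀ hN']
    linarith)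
  rw [← h]
  congr 1; ext k
  rw [nearKernel, norm_scaledPoint, mul_comm]

theorem support_nearKernel_finite {d : ℕ} (K : Euc d → ℂ) {N : ℕ} (hN : 1 ≤ N) :
    (Function.support (nearKernel K N)).Finite := by
  refine (finite_norm_latticePoint_le (2 * N)).subset fun k hk => ?_
  have hN' : (0 : ℝ) < N := by positivity
  by_contra hlt
  simp only [Set.mem_ofPred_eq, not_le] at hlt
  refine hk ?_
  rw [nearKernel, cutoff_of_two_le]
  · simp
  rw [norm_scaledPoint, le_inv_mul_iff₀ hN']
  linarith

theorem CancellingKernel.norm_nearKernel_mul_le {d : ℕ} {K : Euc d → ℂ} {B : ℝ}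
    (hK : CancellingKernel K B) {N : ℕ} (hN : 1 ≤ N) (k : Fin d → ℤ) :
    ‖nearKernel K N k‖ * ‖latticePoint k‖
      ≤ 4 * B * N * (((N : ℝ) ^ d)⁻¹ * radialMajorant d ‖scaledPoint N k‖) := by
  have hB := hK.const_nonneg
  have hN' : (0 : ℝ) < N := by positivity
  rcases le_or_gt ‖scaledPoint N k‖ 2 with h | h
  · have hr : ‖latticePoint k‖ = N * ‖scaledPoint N k‖ := by
      rw [norm_scaledPoint]; field_simp
    have h1 : ‖nearKernel K N k‖ ≤ B * (‖latticePoint k‖ ^ d)⁻¹ := by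
      rw [nearKernel, norm_mul, Complex.norm_real, Real.norm_of_nonneg (cutoff_nonneg _)]
      exact (mul_le_of_le_one_left (norm_nonneg _) (cutoff_le_one _)).trans (hK.norm_le _)
    have h2 := mul_inv_pow_le_radialMajorant (d := d) (norm_nonneg (scaledPoint N k))
      one_le_two h
    calc _ ≤ B * (‖latticePoint k‖ ^ d)⁻¹ * ‖latticePoint k‖ := by gcongr
      _ = B * N * ((N : ℝ) ^ d)⁻¹ * (‖scaledPoint N k‖ * (‖scaledPoint N k‖ ^ d)⁻¹) := by
          rw [hr, mul_pow, mul_inv]; ring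
      _ ≤ B * N * ((N : ℝ) ^ d)⁻¹ * (2 ^ 2 * radialMajorant d ‖scaledPoint N k‖) := by gcongr
      _ = _ := by ring
  · rw [nearKernel, cutoff_of_two_le h.le]
    simp only [Complex.ofReal_zero, zero_mul, norm_zero]
    have := radialMajorant_nonneg (d := d) (norm_nonneg (scaledPoint N k))
    positivity

theorem norm_latticePoint_single {d : ℕ} (j : Fin d) :
    ‖latticePoint (Pi.single j 1 : Fin d → ℤ)‖ = 1 := by
  have : latticePoint (Pi.single j 1 : Fin d → ℤ) = EuclideanSpace.single j (1 : ℝ) := by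
    ext i
    rw [latticePoint_apply]
    by_cases h : i = j
    · subst h; simp
    · simp [h]
  rw [this, PiLp.norm_single, norm_one]

/-- Differences of the part of the kernel away from the origin gain one order of decay. -/
theorem CancellingKernel.norm_farKernel_sub_le {d : ℕ} {K : Euc d → ℂ} {B : ℝ}
    (hK : CancellingKernel K B) {N : ℕ} (hN : 1 ≤ N) (j : Fin d) (k : Fin d → ℤ) :
    ‖(K (latticePoint (k - Pi.single j 1)) - nearKernel K N (k - Pi.single j 1))
        - (K (latticePoint k) - nearKernel K N k)‖
      ≤ 4 * B * (1 + 4 * 2 ^ d) * (N : ℝ)⁻¹ *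
        (((N : ℝ) ^ d)⁻¹ * radialMajorant d ‖scaledPoint N k‖) := by
  have hB := hK.const_nonneg
  have hN' : (0 : ℝ) < N := by positivity
  have hN1 : (1 : ℝ) ≤ N := by exact_mod_cast hN
  set l := k - Pi.single j 1 with hl
  have hmaj := radialMajorant_nonneg (d := d) (norm_nonneg (scaledPoint N k))
  have hnear : ∀ m : Fin d → ℤ, ‖latticePoint m‖ ≤ N → K (latticePoint m) - nearKernel K N m = 0 := by
    intro m hm
    rw [nearKernel, cutoff_of_le_one]
    · simp
    rw [norm_scaledPoint, inv_mul_le_iff₀ hN', mul_one]; exact hm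
  have hkl : ‖latticePoint k - latticePoint l‖ = 1 := by
    rw [← latticePoint_sub, hl, sub_sub_cancel, norm_latticePoint_single]
  have hd1 := norm_sub_norm_le (latticePoint k) (latticePoint l)
  have hd2 := norm_sub_norm_le (latticePoint l) (latticePoint k)
  rw [norm_sub_rev, hkl] at hd2
  rw [hkl] at hd1
  rcases eq_or_ne k 0 with h0 | hk0
  · have h1 : ‖latticePoint k‖ = 0 := by rw [h0, latticePoint_zero, norm_zero]
    rw [hnear k (by linarith), hnear l (by linarith), sub_zero, norm_zero]
    positivity
  rcases eq_or_ne l 0 with h0 | hl0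
  · have h1 : ‖latticePoint l‖ = 0 := by rw [h0, latticePoint_zero, norm_zero]
    rw [hnear k (by linarith), hnear l (by linarith), sub_zero, norm_zero]
    positivity
  have hk1 := one_le_norm_latticePoint hk0
  have hl1 := one_le_norm_latticePoint hl0
  rcases le_or_gt ‖scaledPoint N k‖ (1 / 2) with hsm | hbig
  -- Both points then lie in the ball of radius `N` where the far part vanishes: `|k| ≤ N / 2` and
  -- `|k| ≥ 1` force `N ≥ 2`, so `|l| ≤ N / 2 + 1 ≤ N`.
  · rw [norm_scaledPoint, inv_mul_le_iff₀ hN'] at hsm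
    rw [hnear k (by linarith), hnear l (by linarith), sub_zero, norm_zero]
    positivity
  have hr : ‖latticePoint k‖ = N * ‖scaledPoint N k‖ := by
    rw [norm_scaledPoint]; field_simp
  have hlow := inv_mul_inv_pow_le_radialMajorant (d := d) (show (0 : ℝ) < 1 / 2 by norm_num)
    (by norm_num) hbig.le
  have hx0 : 0 < ‖latticePoint k‖ := by linarith
  have hy0 : 0 < ‖latticePoint l‖ := by linarith
  have hsplit : (K (latticePoint l) - nearKernel K N l) - (K (latticePoint k) - nearKernel K N k)
      = ((1 - cutoff ‖scaledPoint N k‖ : ℝ) : ℂ) * (K (latticePoint l) - K (latticePoint k))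
        + ((cutoff ‖scaledPoint N k‖ - cutoff ‖scaledPoint N l‖ : ℝ) : ℂ) * K (latticePoint l) := by
    simp only [nearKernel]; push_cast; ring
  have e1 : ‖((1 - cutoff ‖scaledPoint N k‖ : ℝ) : ℂ) *
      (K (latticePoint l) - K (latticePoint k))‖
      ≤ B * (‖latticePoint k‖⁻¹ * (‖latticePoint k‖ ^ d)⁻¹) := by
    rw [norm_mul, Complex.norm_real,
      Real.norm_of_nonneg (by linarith [cutoff_le_one ‖scaledPoint N k‖])]
    refine (mul_le_of_le_one_left (norm_nonneg _)
      (by linarith [cutoff_nonneg ‖scaledPoint N k‖])).trans ?_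
    rw [norm_sub_rev]
    refine (hK.norm_sub_le _ _ (norm_pos_iff.1 hx0) (norm_pos_iff.1 hy0) (by linarith)
      (by linarith)).trans (le_of_eq ?_)
    rw [hkl, pow_succ, mul_inv]; ring
  have e2 : ‖((cutoff ‖scaledPoint N k‖ - cutoff ‖scaledPoint N l‖ : ℝ) : ℂ) * K (latticePoint l)‖
      ≤ B * (4 * 2 ^ d) * (‖latticePoint k‖⁻¹ * (‖latticePoint k‖ ^ d)⁻¹) := by
    rcases le_or_gt 4 ‖scaledPoint N k‖ with h4 | h4
    · have h5 : 2 ≤ ‖scaledPoint N l‖ := by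
        rw [norm_scaledPoint, le_inv_mul_iff₀ hN'] at h4 ⊢
        linarith
      rw [cutoff_of_two_le h5, cutoff_of_two_le (by linarith)]
      simp only [sub_self, Complex.ofReal_zero, zero_mul, norm_zero]
      positivity
    have h5 : |cutoff ‖scaledPoint N k‖ - cutoff ‖scaledPoint N l‖| ≤ 4 * ‖latticePoint k‖⁻¹ := by
      refine (abs_cutoff_sub_le _ _).trans ?_
      rw [norm_scaledPoint, norm_scaledPoint, ← mul_sub, abs_mul, abs_of_pos (inv_pos.2 hN')]
      have h6 : |‖latticePoint k‖ - ‖latticePoint l‖| ≤ 1 := abs_le.2 ⟨by linarith, hd1⟩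
      have h8 : ‖latticePoint k‖ ≤ N * 4 := by rw [hr]; gcongr
      calc _ ≤ (N : ℝ)⁻¹ * 1 := by gcongr
        _ ≤ 4 * ‖latticePoint k‖⁻¹ := by
          rw [mul_one, ← div_eq_mul_inv, le_div_iff₀ hx0, inv_mul_le_iff₀ hN']
          exact h8
    have h7 : (‖latticePoint l‖ ^ d)⁻¹ ≤ 2 ^ d * (‖latticePoint k‖ ^ d)⁻¹ := by
      rw [← div_eq_mul_inv, le_div_iff₀ (by positivity), inv_mul_le_iff₀ (by positivity),
        ← mul_pow]
      gcongr
      linarith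
    rw [norm_mul, Complex.norm_real, Real.norm_eq_abs]
    calc _ ≤ (4 * ‖latticePoint k‖⁻¹) * (B * (2 ^ d * (‖latticePoint k‖ ^ d)⁻¹)) := by
          gcongr
          exact (hK.norm_le _).trans (by gcongr)
      _ = _ := by ring
  rw [hsplit]
  calc _ ≤ _ := (norm_add_le _ _).trans (add_le_add e1 e2)
    _ = B * (1 + 4 * 2 ^ d) * ((N : ℝ)⁻¹ * ((N : ℝ) ^ d)⁻¹) *
          (‖scaledPoint N k‖⁻¹ * (‖scaledPoint N k‖ ^ d)⁻¹) := by
        rw [hr, mul_pow, mul_inv, mul_inv]; ring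
    _ ≤ B * (1 + 4 * 2 ^ d) * ((N : ℝ)⁻¹ * ((N : ℝ) ^ d)⁻¹) *
          (((1 / 2) ^ 2)⁻¹ * radialMajorant d ‖scaledPoint N k‖) := by gcongr
    _ = _ := by norm_num; ring

/-! ### The symbol on the torus -/

attribute [local instance] instMeasureSpaceUnitAddCircle

theorem norm_fourier_sub_one_le (n : ℤ) (x : UnitAddCircle) :
    ‖fourier n x - 1‖ ≤ |(n : ℝ)| * ‖fourier 1 x - 1‖ := by
  have hnat : ∀ n : ℕ, ‖fourier (n : ℤ) x - 1‖ ≤ n * ‖fourier 1 x - 1‖ := by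
    intro n
    induction n with
    | zero => simp
    | succ n ih =>
      have h : fourier ((n + 1 : ℕ) : ℤ) x - 1
          = fourier (n : ℤ) x * (fourier 1 x - 1) + (fourier (n : ℤ) x - 1) := by
        push_cast; rw [fourier_add]; ring
      rw [h]
      refine (norm_add_le _ _).trans ?_
      rw [norm_mul]
      have : ‖fourier (n : ℤ) x‖ = 1 := by rw [fourier_apply, Circle.norm_coe]
      rw [this]; push_cast; linarith
  obtain ⟨m, rfl | rfl⟩ := n.eq_nat_or_neg
  · simpa using hnat m
  · have : fourier (-(m : ℤ)) x - 1 = (starRingEnd ℂ) (fourier (m : ℤ) x - 1) := by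
      rw [fourier_neg, map_sub, map_one]
    rw [this, Complex.norm_conj]
    simpa using hnat m

theorem norm_prod_sub_one_le {ι : Type*} (s : Finset ι) (a : ι → ℂ) (ha : ∀ i, ‖a i‖ = 1) :
    ‖∏ i ∈ s, a i - 1‖ ≤ ∑ i ∈ s, ‖a i - 1‖ := by
  classical
  induction s using Finset.induction_on with
  | empty => simp
  | insert i s hi ih =>
    rw [Finset.prod_insert hi, Finset.sum_insert hi]
    have : a i * ∏ j ∈ s, a j - 1 = a i * (∏ j ∈ s, a j - 1) + (a i - 1) := by ring
    rw [this]
    refine (norm_add_le _ _).trans ?_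
    rw [norm_mul, ha, one_mul]
    linarith

/-- The coordinate character `t ↦ e^{2πi t_j}` of the torus. -/
noncomputable def torusCoord {d : ℕ} (j : Fin d) (t : UnitAddTorus (Fin d)) : ℂ :=
  UnitAddTorus.mFourier (Pi.single j 1) t

theorem continuous_torusCoord {d : ℕ} (j : Fin d) : Continuous (torusCoord j) :=
  (UnitAddTorus.mFourier (Pi.single j 1)).continuous

/-- The sum of squares `∑ |e^{2πi t_j} - 1|²`, the symbol of the discrete Laplacian. -/
noncomputable def laplaceSymbol {d : ℕ} (t : UnitAddTorus (Fin d)) : ℝ :=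
  ∑ j, ‖torusCoord j t - 1‖ ^ 2

theorem continuous_laplaceSymbol {d : ℕ} :
    Continuous (laplaceSymbol : UnitAddTorus (Fin d) → ℝ) :=
  continuous_finsetSum _ fun j _ => ((continuous_torusCoord j).sub continuous_const).norm.pow 2

theorem laplaceSymbol_pos {d : ℕ} {t : UnitAddTorus (Fin d)} (ht : t ≠ 0) :
    0 < laplaceSymbol t := by
  obtain ⟨j, hj⟩ := Function.ne_iff.1 ht
  refine lt_of_lt_of_le ?_ (Finset.single_le_sum (fun i _ => by positivity) (Finset.mem_univ j))
  refine pow_pos (norm_pos_iff.2 (sub_ne_zero.2 fun h => hj ?_)) 2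
  rw [torusCoord, UnitAddTorus.mFourier_single, fourier_one] at h
  refine AddCircle.injective_toCircle one_ne_zero ?_
  rw [Pi.zero_apply, AddCircle.toCircle_zero]
  exact Subtype.ext h

theorem norm_torusCoord_sub_one_le {d : ℕ} (j : Fin d) (t : UnitAddTorus (Fin d)) :
    ‖torusCoord j t - 1‖ ≤ √(laplaceSymbol t) := by
  refine Real.le_sqrt_of_sq_le ?_
  exact Finset.single_le_sum (f := fun j => ‖torusCoord j t - 1‖ ^ 2)
    (fun i _ => by positivity) (Finset.mem_univ j)

theorem norm_mFourier_apply {d : ℕ} (m : Fin d → ℤ) (t : UnitAddTorus (Fin d)) :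
    ‖UnitAddTorus.mFourier m t‖ = 1 := by
  simp only [UnitAddTorus.mFourier, ContinuousMap.coe_mk, norm_prod, fourier_apply,
    Circle.norm_coe, Finset.prod_const_one]

theorem norm_mFourier_sub_one_le {d : ℕ} (m : Fin d → ℤ) (t : UnitAddTorus (Fin d)) :
    ‖UnitAddTorus.mFourier m t - 1‖ ≤ ‖latticePoint m‖ * √(laplaceSymbol t) := by
  have h1 : ‖UnitAddTorus.mFourier m t - 1‖ ≤ ∑ j, |(m j : ℝ)| * ‖torusCoord j t - 1‖ := by
    refine (norm_prod_sub_one_le Finset.univ (fun j => fourier (m j) (t j)) fun j => by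
      rw [fourier_apply, Circle.norm_coe]).trans (Finset.sum_le_sum fun j _ => ?_)
    rw [torusCoord, UnitAddTorus.mFourier_single]
    exact norm_fourier_sub_one_le _ _
  refine h1.trans ((Real.sum_mul_le_sqrt_mul_sqrt _ _ _).trans (le_of_eq ?_))
  rw [EuclideanSpace.norm_eq, laplaceSymbol]
  simp [latticePoint_apply]

/-- Multiplication by `e^{2πi t_j} - 1` turns into a difference of the coefficients. -/
theorem hasSum_sub_mul_mFourier {d : ℕ} {a : (Fin d → ℤ) → ℂ} {t : UnitAddTorus (Fin d)} {s : ℂ}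
    (h : HasSum (fun k => a k * UnitAddTorus.mFourier k t) s) (j : Fin d) :
    HasSum (fun k => (a (k - Pi.single j 1) - a k) * UnitAddTorus.mFourier k t)
      ((torusCoord j t - 1) * s) := by
  have h1 : HasSum (fun k => a (k - Pi.single j 1) * UnitAddTorus.mFourier k t)
      (torusCoord j t * s) := by
    rw [← (Equiv.addRight (Pi.single j 1 : Fin d → ℤ)).hasSum_iff]
    refine (h.mul_left (torusCoord j t)).congr_fun fun k => ?_
    simp only [Function.comp, Equiv.coe_addRight, add_sub_cancel_right, UnitAddTorus.mFourier_add,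
      torusCoord]
    ring
  rw [sub_mul, one_mul]
  exact (h1.sub h).congr_fun fun k => by ring

/-! ### Boundedness of the symbol -/

/-- The `j`-th difference of the lattice kernel. -/
noncomputable def kernelDiff {d : ℕ} (K : Euc d → ℂ) (j : Fin d) (k : Fin d → ℤ) : ℂ :=
  K (latticePoint (k - Pi.single j 1)) - K (latticePoint k)

theorem CancellingKernel.exists_tsum_farKernel_sub_le {d : ℕ} [NeZero d] {K : Euc d → ℂ} {B : ℝ}
    (hK : CancellingKernel K B) :
    ∃ C : ℝ, 0 ≤ C ∧ ∀ N : ℕ, 1 ≤ N → ∀ j : Fin d,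
      Summable (fun k => ‖kernelDiff K j k -
        (nearKernel K N (k - Pi.single j 1) - nearKernel K N k)‖) ∧
      ∑' k, ‖kernelDiff K j k - (nearKernel K N (k - Pi.single j 1) - nearKernel K N k)‖
        ≤ C * (N : ℝ)⁻¹ := by
  obtain ⟨C, hC, h⟩ := exists_tsum_radialMajorant_le d
  have hB := hK.const_nonneg
  refine ⟨4 * B * (1 + 4 * 2 ^ d) * C, by positivity, fun N hN j => ?_⟩
  obtain ⟨h1, h2⟩ := h N hN
  have hle : ∀ k, ‖kernelDiff K j k - (nearKernel K N (k - Pi.single j 1) - nearKernel K N k)‖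
      ≤ 4 * B * (1 + 4 * 2 ^ d) * (N : ℝ)⁻¹ *
        (((N : ℝ) ^ d)⁻¹ * radialMajorant d ‖scaledPoint N k‖) := by
    intro k
    refine le_trans (le_of_eq ?_) (hK.norm_farKernel_sub_le hN j k)
    congr 1
    simp only [kernelDiff]; ring
  have h3 := h1.mul_left (4 * B * (1 + 4 * 2 ^ d) * (N : ℝ)⁻¹)
  have h4 := Summable.of_nonneg_of_le (fun k => norm_nonneg _) hle h3
  refine ⟨h4, (h4.tsum_le_tsum hle h3).trans ?_⟩
  rw [tsum_mul_left]
  calc _ ≤ 4 * B * (1 + 4 * 2 ^ d) * (N : ℝ)⁻¹ * C := by gcongr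
    _ = _ := by ring

theorem CancellingKernel.summable_norm_kernelDiff {d : ℕ} [NeZero d] {K : Euc d → ℂ} {B : ℝ}
    (hK : CancellingKernel K B) (j : Fin d) : Summable fun k => ‖kernelDiff K j k‖ := by
  obtain ⟨C, -, h⟩ := hK.exists_tsum_farKernel_sub_le
  have h1 := (h 1 le_rfl j).1.of_norm
  have h2 : Summable (nearKernel K 1) :=
    summable_of_hasFiniteSupport (support_nearKernel_finite K le_rfl)
  have h3 : Summable fun k : Fin d → ℤ => nearKernel K 1 (k - Pi.single j 1) :=
    (Equiv.subRight (Pi.single j 1 : Fin d → ℤ)).summable_iff.2 h2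
  refine ((h1.add (h3.sub h2)).congr fun k => ?_).norm
  ring

/-- The continuous function on the torus whose Fourier coefficients are the `j`-th differences of
the kernel; it equals `e^{2πi t_j} - 1` times the symbol. -/
noncomputable def diffSymbol {d : ℕ} (K : Euc d → ℂ) (j : Fin d) : C(UnitAddTorus (Fin d), ℂ) :=
  ∑' k, kernelDiff K j k • UnitAddTorus.mFourier k

theorem CancellingKernel.hasSum_diffSymbol {d : ℕ} [NeZero d] {K : Euc d → ℂ} {B : ℝ}
    (hK : CancellingKernel K B) (j : Fin d) :
    HasSum (fun k => kernelDiff K j k • UnitAddTorus.mFourier k) (diffSymbol K j) := by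
  refine Summable.hasSum (Summable.of_norm ?_)
  simpa only [norm_smul, UnitAddTorus.mFourier_norm, mul_one] using hK.summable_norm_kernelDiff j

theorem CancellingKernel.hasSum_diffSymbol_apply {d : ℕ} [NeZero d] {K : Euc d → ℂ} {B : ℝ}
    (hK : CancellingKernel K B) (j : Fin d) (t : UnitAddTorus (Fin d)) :
    HasSum (fun k => kernelDiff K j k * UnitAddTorus.mFourier k t) (diffSymbol K j t) := by
  simpa only [map_smul] using! (ContinuousMap.evalCLM ℂ t).hasSum (hK.hasSum_diffSymbol j)

/-- The symbol of the Toeplitz matrix `K(m - n)` as a function on the torus. Only the differences of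
the coefficients are summable, so it is recovered from the functions `(e^{2πi t_j} - 1) F(t)` by
weighted averaging over `j`. At `t = 0` the value is `0` by convention. -/
noncomputable def torusSymbol {d : ℕ} (K : Euc d → ℂ) (t : UnitAddTorus (Fin d)) : ℂ :=
  (∑ j, (starRingEnd ℂ) (torusCoord j t - 1) * diffSymbol K j t) / (laplaceSymbol t : ℂ)

theorem continuousAt_torusSymbol {d : ℕ} (K : Euc d → ℂ) {t : UnitAddTorus (Fin d)} (ht : t ≠ 0) :
    ContinuousAt (torusSymbol K) t := by
  refine ContinuousAt.div ?_ ?_ (by exact_mod_cast (laplaceSymbol_pos ht).ne')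
  · refine Continuous.continuousAt (continuous_finsetSum _ fun j _ => ?_)
    exact (Complex.continuous_conj.comp ((continuous_torusCoord j).sub continuous_const)).mul
      (diffSymbol K j).continuous
  · exact (Complex.continuous_ofReal.comp continuous_laplaceSymbol).continuousAt

theorem measurable_torusSymbol {d : ℕ} (K : Euc d → ℂ) : Measurable (torusSymbol K) := by
  refine Measurable.div ?_ ?_
  · refine Continuous.measurable (continuous_finsetSum _ fun j _ => ?_)
    exact (Complex.continuous_conj.comp ((continuous_torusCoord j).sub continuous_const)).mul
      (diffSymbol K j).continuous
  · exact (Complex.continuous_ofReal.comp continuous_laplaceSymbol).measurable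

theorem sum_conj_mul_torusCoord {d : ℕ} (t : UnitAddTorus (Fin d)) :
    ∑ j, (starRingEnd ℂ) (torusCoord j t - 1) * (torusCoord j t - 1) = (laplaceSymbol t : ℂ) := by
  rw [laplaceSymbol]
  push_cast
  exact Finset.sum_congr rfl fun j _ => Complex.conj_mul' _

theorem laplaceSymbol_le {d : ℕ} (t : UnitAddTorus (Fin d)) : laplaceSymbol t ≤ 4 * d := by
  calc laplaceSymbol t ≤ ∑ j : Fin d, (4 : ℝ) := by
        refine Finset.sum_le_sum fun j _ => ?_
        have h : ‖torusCoord j t - 1‖ ≤ 2 := by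
          refine (norm_sub_le _ _).trans ?_
          rw [torusCoord, norm_mFourier_apply, norm_one]; norm_num
        nlinarith [norm_nonneg (torusCoord j t - 1)]
    _ = 4 * d := by simp [mul_comm]

/-- The symbol is bounded: at `t` the kernel is split at the scale `N ∼ |t|⁻¹`; the near part is
controlled by cancellation and the far part by summation by parts. -/
theorem CancellingKernel.exists_norm_torusSymbol_le {d : ℕ} [NeZero d] {K : Euc d → ℂ} {B : ℝ}
    (hK : CancellingKernel K B) : ∃ M : ℝ, 0 ≤ M ∧ ∀ t, ‖torusSymbol K t‖ ≤ M := by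
  obtain ⟨C, hC, hnear⟩ := exists_tsum_radialMajorant_le d
  obtain ⟨C', hC', hfar⟩ := hK.exists_tsum_farKernel_sub_le
  have hB := hK.const_nonneg
  refine ⟨4 * B * C * (1 + √(4 * d)) + d * C', by positivity, fun t => ?_⟩
  rcases eq_or_ne t 0 with rfl | ht
  · have : laplaceSymbol (0 : UnitAddTorus (Fin d)) = 0 := by
      refine Finset.sum_eq_zero fun j _ => ?_
      rw [torusCoord, UnitAddTorus.mFourier_single]; simp
    rw [torusSymbol, this, Complex.ofReal_zero, div_zero, norm_zero]
    positivity
  have hL := laplaceSymbol_pos ht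
  set δ := √(laplaceSymbol t)
  have hδ0 : 0 < δ := Real.sqrt_pos.2 hL
  have hδ2 : laplaceSymbol t = δ ^ 2 := (Real.sq_sqrt hL.le).symm
  have hδle : δ ≤ √(4 * d) := Real.sqrt_le_sqrt (laplaceSymbol_le t)
  -- The splitting scale is comparable to the inverse distance of `t` from the origin.
  set N := ⌈δ⁻¹⌉₊
  have hN : 1 ≤ N := Nat.one_le_ceil_iff.2 (inv_pos.2 hδ0)
  have hN' : (0 : ℝ) < N := by positivity
  have hNδ : 1 ≤ N * δ := by
    have := Nat.le_ceil δ⁻¹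
    rw [inv_le_iff_one_le_mul₀ hδ0] at this
    exact this
  have hNδ' : N * δ ≤ 1 + √(4 * d) := by
    have h := (Nat.ceil_lt_add_one (inv_pos.2 hδ0).le).le
    calc (N : ℝ) * δ ≤ (δ⁻¹ + 1) * δ := by gcongr
      _ = 1 + δ := by field_simp
      _ ≤ _ := by linarith
  obtain ⟨hs, hsle⟩ := hnear N hN
  have hsup := support_nearKernel_finite K hN
  have hPs : Summable fun k => nearKernel K N k * UnitAddTorus.mFourier k t :=
    summable_of_hasFiniteSupport (hsup.subset fun k hk => left_ne_zero_of_mul hk)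
  have hns : Summable (nearKernel K N) := summable_of_hasFiniteSupport hsup
  set P := ∑' k, nearKernel K N k * UnitAddTorus.mFourier k t
  have hPle : ‖P‖ ≤ 4 * B * C * (1 + √(4 * d)) := by
    have h0 : P = ∑' k, nearKernel K N k * (UnitAddTorus.mFourier k t - 1) := by
      simp only [mul_sub, mul_one]
      rw [hPs.tsum_sub hns, hK.tsum_nearKernel hN, sub_zero]
    have hle : ∀ k, ‖nearKernel K N k * (UnitAddTorus.mFourier k t - 1)‖
        ≤ 4 * B * N * δ * (((N : ℝ) ^ d)⁻¹ * radialMajorant d ‖scaledPoint N k‖) := by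
      intro k
      rw [norm_mul]
      calc _ ≤ ‖nearKernel K N k‖ * (‖latticePoint k‖ * δ) := by
            gcongr; exact norm_mFourier_sub_one_le k t
        _ = (‖nearKernel K N k‖ * ‖latticePoint k‖) * δ := by ring
        _ ≤ (4 * B * N * (((N : ℝ) ^ d)⁻¹ * radialMajorant d ‖scaledPoint N k‖)) * δ :=
            mul_le_mul_of_nonneg_right (hK.norm_nearKernel_mul_le hN k) hδ0.le
        _ = _ := by ring
    rw [h0]
    refine (tsum_of_norm_bounded (hs.mul_left _).hasSum hle).trans ?_
    rw [tsum_mul_left]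
    calc _ ≤ 4 * B * N * δ * C := by gcongr
      _ = 4 * B * C * (N * δ) := by ring
      _ ≤ _ := by gcongr
  -- The rest is again an average of its products with `e^{2πi t_j} - 1`, whose coefficients are
  -- the differences of the far part.
  have hdiff : torusSymbol K t - P = (∑ j, (starRingEnd ℂ) (torusCoord j t - 1) *
      (diffSymbol K j t - (torusCoord j t - 1) * P)) / (laplaceSymbol t : ℂ) := by
    have hL' : (laplaceSymbol t : ℂ) ≠ 0 := by exact_mod_cast hL.ne'
    rw [torusSymbol, eq_div_iff hL', sub_mul, div_mul_cancel₀ _ hL',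
      ← sum_conj_mul_torusCoord t, Finset.mul_sum, ← Finset.sum_sub_distrib]
    exact Finset.sum_congr rfl fun j _ => by ring
  have hj : ∀ j, ‖diffSymbol K j t - (torusCoord j t - 1) * P‖ ≤ C' * (N : ℝ)⁻¹ := by
    intro j
    obtain ⟨hf, hfle⟩ := hfar N hN j
    have h1 := (hK.hasSum_diffSymbol_apply j t).sub (hasSum_sub_mul_mFourier hPs.hasSum j)
    rw [← h1.tsum_eq]
    refine (tsum_of_norm_bounded hf.hasSum fun k => le_of_eq ?_).trans hfle
    rw [← sub_mul, norm_mul, norm_mFourier_apply, mul_one]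
  have hrest : ‖torusSymbol K t - P‖ ≤ d * C' := by
    rw [hdiff, norm_div, Complex.norm_real, Real.norm_of_nonneg hL.le, div_le_iff₀ hL]
    calc _ ≤ ∑ j : Fin d, δ * (C' * (N : ℝ)⁻¹) := by
          refine (norm_sum_le _ _).trans (Finset.sum_le_sum fun j _ => ?_)
          rw [norm_mul, Complex.norm_conj]
          gcongr
          · exact norm_torusCoord_sub_one_le j t
          · exact hj j
      _ = d * C' * (δ * (N : ℝ)⁻¹) := by simp; ring
      _ ≤ d * C' * laplaceSymbol t := by
          gcongr
          rw [hδ2, ← div_eq_mul_inv, div_le_iff₀ hN']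
          nlinarith
  calc ‖torusSymbol K t‖ = ‖P + (torusSymbol K t - P)‖ := by rw [add_sub_cancel]
    _ ≤ _ := (norm_add_le _ _).trans (add_le_add hPle hrest)

/-! ### Toeplitz operators -/

/-- Multiplication by a bounded function on `L²`. -/
noncomputable def boundedMul {α : Type*} [MeasurableSpace α] {μ : Measure α} (φ : Lp ℂ ∞ μ) :
    Lp ℂ 2 μ →L[ℂ] Lp ℂ 2 μ :=
  (ContinuousLinearMap.mul ℂ ℂ).holderL μ ∞ 2 2 φ

theorem coeFn_boundedMul {α : Type*} [MeasurableSpace α] {μ : Measure α} (φ : Lp ℂ ∞ μ)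
    (f : Lp ℂ 2 μ) : boundedMul φ f =ᵐ[μ] fun x => φ x * f x :=
  (ContinuousLinearMap.mul ℂ ℂ).coeFn_holder φ f

instance isProbabilityMeasure_unitAddCircle :
    IsProbabilityMeasure (volume : Measure UnitAddCircle) :=
  inferInstanceAs (IsProbabilityMeasure AddCircle.haarAddCircle)

theorem ae_ne_zero_torus {d : ℕ} [NeZero d] : ∀ᵐ t : UnitAddTorus (Fin d), t ≠ 0 := by
  have h1 : AddCircle.haarAddCircle ({0} : Set UnitAddCircle) = 0 := by
    have h := AddCircle.volume_eq_smul_haarAddCircle (T := 1)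
    rw [ENNReal.ofReal_one, one_smul] at h
    rw [← h]
    simpa using AddCircle.volume_closedBall (T := 1) (x := 0) 0
  rw [ae_iff]
  simp only [not_not, Set.ofPred_eq_eq_singleton]
  have h2 : ({0} : Set (UnitAddTorus (Fin d))) = Set.univ.pi fun _ => {0} := by
    ext t; simp [funext_iff]
  rw [h2, volume_pi_pi]
  exact Finset.prod_eq_zero (Finset.mem_univ 0) h1

theorem CancellingKernel.memℓp {d : ℕ} [NeZero d] {K : Euc d → ℂ} {B : ℝ}
    (hK : CancellingKernel K B) : Memℓp (fun k : Fin d → ℤ => K (latticePoint k)) 2 := by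
  obtain ⟨C, -, h⟩ := exists_tsum_radialMajorant_le d
  have hs := (h 1 le_rfl).1.mul_left (B ^ 2)
  refine memℓp_gen (Summable.of_nonneg_of_le (fun k => by positivity) (fun k => ?_) hs)
  simp only [ENNReal.toReal_ofNat, Real.rpow_ofNat]
  rcases eq_or_ne k 0 with rfl | hk
  · rw [latticePoint_zero, hK.map_zero, scaledPoint_zero, norm_zero, norm_zero,
      radialMajorant_zero]
    simp
  have h1 := one_le_norm_latticePoint hk
  have h2 := inv_mul_inv_pow_le_radialMajorant (d := d) one_pos le_rfl h1
  have h3 : ‖scaledPoint 1 k‖ = ‖latticePoint k‖ := by rw [norm_scaledPoint]; simp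
  rw [h3]
  have h4 : (‖latticePoint k‖ ^ d)⁻¹ ≤ ‖latticePoint k‖⁻¹ := by
    gcongr
    exact le_self_pow₀ h1 (NeZero.ne d)
  calc ‖K (latticePoint k)‖ ^ 2 ≤ (B * (‖latticePoint k‖ ^ d)⁻¹) ^ 2 := by
        gcongr; exact hK.norm_le _
    _ = B ^ 2 * ((‖latticePoint k‖ ^ d)⁻¹ * (‖latticePoint k‖ ^ d)⁻¹) := by ring
    _ ≤ B ^ 2 * (‖latticePoint k‖⁻¹ * (‖latticePoint k‖ ^ d)⁻¹) := by gcongr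
    _ ≤ B ^ 2 * ((1 ^ 2)⁻¹ * radialMajorant d ‖latticePoint k‖) := by gcongr
    _ = _ := by simp

/-- The symbol is the sum in `L²` of its Fourier series, with coefficients `K(m)`. -/
theorem CancellingKernel.exists_hasSum_torusSymbol {d : ℕ} [NeZero d] {K : Euc d → ℂ} {B : ℝ}
    (hK : CancellingKernel K B) :
    ∃ f : Lp ℂ 2 (volume : Measure (UnitAddTorus (Fin d))),
      f =ᵐ[volume] torusSymbol K ∧
      HasSum (fun k => K (latticePoint k) • UnitAddTorus.mFourierLp 2 k) f := by
  let f := (UnitAddTorus.mFourierBasis (d := Fin d)).repr.symm ⟨_, hK.memℓp⟩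
  have hf : HasSum (fun k => K (latticePoint k) • UnitAddTorus.mFourierLp 2 k) f := by
    have := (UnitAddTorus.mFourierBasis (d := Fin d)).hasSum_repr_symm ⟨_, hK.memℓp⟩
    simpa only [UnitAddTorus.coe_mFourierBasis] using this
  refine ⟨f, ?_, hf⟩
  -- Both sides have the differences of the kernel as Fourier coefficients.
  have key : ∀ j, ∀ᵐ t, (torusCoord j t - 1) * f t = diffSymbol K j t := by
    intro j
    let φ : C(UnitAddTorus (Fin d), ℂ) := UnitAddTorus.mFourier (Pi.single j 1)
    have hφ := ContinuousMap.coeFn_toLp (p := ∞) (𝕜 := ℂ) (volume : Measure (UnitAddTorus (Fin d))) φ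
    let M := boundedMul (ContinuousMap.toLp (E := ℂ) ∞ volume ℂ φ)
    have hM : ∀ k, M (UnitAddTorus.mFourierLp 2 k)
        = UnitAddTorus.mFourierLp 2 (k + Pi.single j 1) := by
      intro k
      apply Lp.ext
      filter_upwards [coeFn_boundedMul (ContinuousMap.toLp (E := ℂ) ∞ volume ℂ φ)
        (UnitAddTorus.mFourierLp 2 k), hφ, UnitAddTorus.coeFn_mFourierLp 2 k,
        UnitAddTorus.coeFn_mFourierLp 2 (k + Pi.single j 1)] with t h1 h2 h3 h4
      rw [h1, h2, h3, h4, UnitAddTorus.mFourier_add, mul_comm]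
    have h1 : HasSum (fun k => K (latticePoint (k - Pi.single j 1)) •
        UnitAddTorus.mFourierLp 2 k) (M f) := by
      rw [← (Equiv.addRight (Pi.single j 1 : Fin d → ℤ)).hasSum_iff]
      refine (M.hasSum hf).congr_fun fun k => ?_
      rw [M.map_smul, hM]
      simp
    have h2 : HasSum (fun k => kernelDiff K j k • UnitAddTorus.mFourierLp 2 k) (M f - f) :=
      (h1.sub hf).congr_fun fun k => by rw [kernelDiff, sub_smul]
    have h3 : HasSum (fun k => kernelDiff K j k • UnitAddTorus.mFourierLp 2 k)
        (ContinuousMap.toLp (E := ℂ) 2 volume ℂ (diffSymbol K j)) := by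
      simpa only [map_smul] using!
        (ContinuousMap.toLp (E := ℂ) 2 (volume : Measure (UnitAddTorus (Fin d))) ℂ).hasSum
          (hK.hasSum_diffSymbol j)
    have h4 := h2.unique h3
    filter_upwards [coeFn_boundedMul (ContinuousMap.toLp (E := ℂ) ∞ volume ℂ φ) f, hφ,
      Lp.coeFn_sub (M f) f,
      ContinuousMap.coeFn_toLp (p := 2) (𝕜 := ℂ) (volume : Measure (UnitAddTorus (Fin d)))
        (diffSymbol K j)] with t e1 e2 e3 e4
    rw [← e4, ← h4, e3, Pi.sub_apply, e1, e2, sub_mul, one_mul]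
    rfl
  filter_upwards [ae_all_iff.2 key, ae_ne_zero_torus] with t ht ht0
  have hL : (laplaceSymbol t : ℂ) ≠ 0 := by exact_mod_cast (laplaceSymbol_pos ht0).ne'
  rw [torusSymbol, eq_div_iff hL, ← sum_conj_mul_torusCoord, Finset.mul_sum]
  refine Finset.sum_congr rfl fun j _ => ?_
  rw [← ht j]; ring

/-- The Toeplitz matrix `K(m - n)`, compressed to any set of lattice points, is a bounded operator;
its bound is uniform, and its quadratic form obeys every affine bound satisfied by the symbol. -/
theorem CancellingKernel.exists_toeplitz {d : ℕ} [NeZero d] {K : Euc d → ℂ} {B : ℝ}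
    (hK : CancellingKernel K B) :
    ∃ M : ℝ, 0 ≤ M ∧ ∀ (ι : Type) (e : ι → Fin d → ℤ), Function.Injective e →
      ∃ T : lp (fun _ : ι => ℂ) 2 →L[ℂ] lp (fun _ : ι => ℂ) 2,
        (∀ U m, HasSum (fun n => K (latticePoint (e m - e n)) * U n) (T U m)) ∧
        (∀ U, ‖T U‖ ≤ M * ‖U‖) ∧
        ∀ (l : ℂ →L[ℝ] ℝ) (s : ℝ), (∀ t, t ≠ 0 → l (torusSymbol K t) ≤ s) →
          ∀ U, l (inner ℂ U (T U)) ≤ s * ‖U‖ ^ 2 := by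
  classical
  obtain ⟨M₀, -, hM₀⟩ := hK.exists_norm_torusSymbol_le
  obtain ⟨f, hfF, hf⟩ := hK.exists_hasSum_torusSymbol
  have hmem : MemLp (torusSymbol K) ∞ (volume : Measure (UnitAddTorus (Fin d))) :=
    memLp_top_of_bound (measurable_torusSymbol K).aestronglyMeasurable M₀
      (Eventually.of_forall hM₀)
  let F := hmem.toLp
  have hF : F =ᵐ[volume] torusSymbol K := hmem.coeFn_toLp
  let Λ := boundedMul F
  have hΛ : ∀ g, Λ g =ᵐ[volume] fun t => torusSymbol K t * g t := by
    intro g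
    filter_upwards [coeFn_boundedMul F g, hF] with t h1 h2
    rw [h1, h2]
  have hentry : ∀ m n, inner ℂ (UnitAddTorus.mFourierLp 2 m) (Λ (UnitAddTorus.mFourierLp 2 n))
      = K (latticePoint (m - n)) := by
    intro m n
    have h1 : inner ℂ (UnitAddTorus.mFourierLp 2 (m - n)) f = K (latticePoint (m - n)) := by
      have h2 := (innerSL ℂ (UnitAddTorus.mFourierLp (d := Fin d) 2 (m - n))).hasSum hf
      refine h2.unique ((hasSum_ite_eq (m - n) (K (latticePoint (m - n)))).congr_fun fun k => ?_)
      rw [innerSL_apply_apply, inner_smul_right,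
        orthonormal_iff_ite.1 (UnitAddTorus.orthonormal_mFourier (d := Fin d))]
      by_cases h : m - n = k
      · simp [h]
      · simp [h, Ne.symm h]
    rw [← h1, L2.inner_def, L2.inner_def]
    refine integral_congr_ae ?_
    filter_upwards [hΛ (UnitAddTorus.mFourierLp 2 n), hfF, UnitAddTorus.coeFn_mFourierLp 2 n,
      UnitAddTorus.coeFn_mFourierLp 2 m, UnitAddTorus.coeFn_mFourierLp 2 (m - n)]
      with t e1 e2 e3 e4 e5
    rw [e1, e2, e3, e4, e5, RCLike.inner_apply, RCLike.inner_apply, sub_eq_add_neg,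
      UnitAddTorus.mFourier_add, UnitAddTorus.mFourier_neg, map_mul, Complex.conj_conj]
    ring
  refine ⟨‖Λ‖, norm_nonneg _, fun ι e he => ?_⟩
  have hon := (UnitAddTorus.orthonormal_mFourier (d := Fin d)).comp e he
  let V := hon.orthogonalFamily.linearIsometry
  have hV : ∀ U, HasSum (fun n => U n • UnitAddTorus.mFourierLp 2 (e n)) (V U) := fun U =>
    hon.orthogonalFamily.hasSum_linearIsometry U
  have hV1 : ∀ m, V (lp.single 2 m (1 : ℂ)) = UnitAddTorus.mFourierLp 2 (e m) := by
    intro m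
    refine (hon.orthogonalFamily.linearIsometry_apply_single (1 : ℂ)).trans ?_
    simp
  let V' := V.toContinuousLinearMap
  let T := (ContinuousLinearMap.adjoint V').comp (Λ.comp V')
  have hT : ∀ W U, inner ℂ W (T U) = inner ℂ (V W) (Λ (V U)) := fun W U =>
    ContinuousLinearMap.adjoint_inner_right V' W (Λ (V' U))
  refine ⟨T, fun U m => ?_, fun U => ?_, fun l s hls U => ?_⟩
  · have h1 : T U m = inner ℂ (UnitAddTorus.mFourierLp 2 (e m)) (Λ (V U)) := by
      rw [← hV1, ← hT, lp.inner_single_left]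
      simp
    rw [h1]
    have h2 := ((innerSL ℂ (UnitAddTorus.mFourierLp (d := Fin d) 2 (e m))).comp Λ).hasSum (hV U)
    refine h2.congr_fun fun n => ?_
    rw [ContinuousLinearMap.comp_apply, innerSL_apply_apply, Λ.map_smul, inner_smul_right, hentry,
      mul_comm]
  · have hV' : ‖V'‖ ≤ 1 := V.norm_toContinuousLinearMap_le
    calc ‖T U‖ ≤ ‖ContinuousLinearMap.adjoint V'‖ * ‖Λ (V U)‖ :=
          (ContinuousLinearMap.adjoint V').le_opNorm _
      _ ≤ 1 * (‖Λ‖ * ‖V U‖) := by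
          gcongr
          · rw [LinearIsometryEquiv.norm_map]; exact hV'
          · exact Λ.le_opNorm _
      _ = ‖Λ‖ * ‖U‖ := by rw [one_mul, V.norm_map]
  · rw [hT, ← V.norm_map U]
    set g := V U
    have h1 := L2.integrable_inner (𝕜 := ℂ) g (Λ g)
    have h2 := L2.integrable_inner (𝕜 := ℂ) g g
    rw [L2.inner_def, ← l.integral_comp_comm h1]
    have h3 : ‖g‖ ^ 2 = ∫ t, ‖g t‖ ^ 2 := by
      rw [← inner_self_eq_norm_sq (𝕜 := ℂ) g, L2.inner_def, ← integral_re h2]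
      simp only [inner_self_eq_norm_sq]
    have h4 : Integrable fun t => ‖g t‖ ^ 2 := by
      have := h2.re
      simpa only [inner_self_eq_norm_sq] using this
    rw [h3, ← integral_const_mul]
    refine integral_mono_ae (l.integrable_comp h1) (h4.const_mul s) ?_
    filter_upwards [hΛ g, ae_ne_zero_torus] with t e1 e2
    have e3 : inner ℂ (g t) (Λ g t) = (‖g t‖ ^ 2) • torusSymbol K t := by
      rw [e1, RCLike.inner_apply, mul_assoc, Complex.mul_conj', Complex.real_smul]
      push_cast; ring
    simp only [e3]
    rw [l.map_smul, smul_eq_mul, mul_comm s]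
    exact mul_le_mul_of_nonneg_left (hls t e2) (sq_nonneg _)

/-! ### The principal value operator -/

theorem CancellingKernel.continuousAt {d : ℕ} {K : Euc d → ℂ} {B : ℝ}
    (hK : CancellingKernel K B) {z : Euc d} (hz : z ≠ 0) : ContinuousAt K z := by
  have hz' : 0 < ‖z‖ := norm_pos_iff.2 hz
  rw [ContinuousAt, tendsto_iff_norm_sub_tendsto_zero]
  have h1 : Tendsto (fun w => B * ‖z - w‖ * (‖z‖ ^ (d + 1))⁻¹) (𝓝 z) (𝓝 0) := by
    have : Continuous fun w => B * ‖z - w‖ * (‖z‖ ^ (d + 1))⁻¹ := by fun_prop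
    simpa using this.tendsto z
  refine squeeze_zero' (Eventually.of_forall fun _ => norm_nonneg _) ?_ h1
  filter_upwards [Metric.ball_mem_nhds z (half_pos hz')] with w hw
  rw [Metric.mem_ball, dist_eq_norm] at hw
  have h2 := norm_sub_norm_le w z
  have h3 := norm_sub_norm_le z w
  rw [norm_sub_rev] at h3
  have hw0 : 0 < ‖w‖ := by linarith
  rw [norm_sub_rev]
  exact hK.norm_sub_le z w hz (norm_pos_iff.1 hw0) (by linarith) (by linarith)

theorem CancellingKernel.measurable {d : ℕ} {K : Euc d → ℂ} {B : ℝ}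
    (hK : CancellingKernel K B) : Measurable K :=
  measurable_of_continuousOn_compl_singleton 0 fun _ hz =>
    (hK.continuousAt hz).continuousWithinAt

/-- The regularized integrand `K(z) (φ(x - z) - η(|z|) φ(x))`, with `η` the cutoff. -/
noncomputable def pvIntegrand {d : ℕ} (K : Euc d → ℂ) (φ : 𝓢(Euc d, ℂ)) (x z : Euc d) : ℂ :=
  K z * (φ (x - z) - (cutoff ‖z‖ : ℂ) * φ x)

/-- Convolution with the principal value of `K`, as an absolutely convergent integral. -/
noncomputable def pvConv {d : ℕ} (K : Euc d → ℂ) (φ : 𝓢(Euc d, ℂ)) (x : Euc d) : ℂ :=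
  ∫ z, pvIntegrand K φ x z

theorem SchwartzMap.exists_norm_le {d : ℕ} (φ : 𝓢(Euc d, ℂ)) (k : ℕ) :
    ∃ C : ℝ, 0 ≤ C ∧ ∀ x, ‖x‖ ^ k * ‖φ x‖ ≤ C := by
  obtain ⟨C, hC, h⟩ := φ.decay k 0
  exact ⟨C, hC.le, fun x => by simpa using h x⟩

theorem SchwartzMap.exists_norm_sub_le {d : ℕ} (φ : 𝓢(Euc d, ℂ)) :
    ∃ L : ℝ, 0 ≤ L ∧ ∀ x y, ‖φ x - φ y‖ ≤ L * ‖x - y‖ := by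
  obtain ⟨L, hL, h⟩ := φ.decay 0 1
  refine ⟨L, hL.le, fun x y => ?_⟩
  refine Convex.norm_image_sub_le_of_norm_fderiv_le (𝕜 := ℝ) (s := Set.univ)
    (fun z _ => φ.differentiableAt) (fun z _ => ?_) convex_univ (Set.mem_univ y) (Set.mem_univ x)
  have := h z
  rwa [pow_zero, one_mul, norm_iteratedFDeriv_one] at this

/-- Near the origin the Lipschitz bound for `φ` gains a factor `|z|`; away from it, decay of `φ` (up
to a factor depending on `x`) and the bounded support of the cutoff gain a factor `|z|⁻¹`. -/
theorem CancellingKernel.exists_norm_pvIntegrand_le {d : ℕ} {K : Euc d → ℂ} {B : ℝ}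
    (hK : CancellingKernel K B) (φ : 𝓢(Euc d, ℂ)) :
    ∃ A : ℝ, 0 ≤ A ∧ ∀ x z, ‖pvIntegrand K φ x z‖ ≤ A * (1 + ‖x‖) * radialMajorant d ‖z‖ := by
  have hB := hK.const_nonneg
  obtain ⟨L, hL, hLip⟩ := φ.exists_norm_sub_le
  obtain ⟨S₀, hS₀, h0⟩ := φ.exists_norm_le 0
  obtain ⟨S₁, hS₁, h1⟩ := φ.exists_norm_le 1
  simp only [pow_zero, one_mul, pow_one] at h0 h1
  refine ⟨B * (L + S₁ + 3 * S₀), by positivity, fun x z => ?_⟩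
  have hx := norm_nonneg x
  have hmaj := radialMajorant_nonneg (d := d) (norm_nonneg z)
  rw [pvIntegrand, norm_mul]
  rcases le_or_gt ‖z‖ 1 with hz | hz
  · rw [cutoff_of_le_one hz, Complex.ofReal_one, one_mul]
    have h2 : ‖φ (x - z) - φ x‖ ≤ L * ‖z‖ := by simpa using hLip (x - z) x
    have h3 := mul_inv_pow_le_radialMajorant (d := d) (norm_nonneg z) le_rfl hz
    rw [one_pow, one_mul] at h3
    calc _ ≤ (B * (‖z‖ ^ d)⁻¹) * (L * ‖z‖) := by
          gcongr; exact hK.norm_le z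
      _ = B * L * 1 * (‖z‖ * (‖z‖ ^ d)⁻¹) := by ring
      _ ≤ B * (L + S₁ + 3 * S₀) * (1 + ‖x‖) * radialMajorant d ‖z‖ := by
          gcongr <;> linarith
  · have hz0 : 0 < ‖z‖ := by linarith
    have h3 := inv_mul_inv_pow_le_radialMajorant (d := d) one_pos le_rfl hz.le
    rw [one_pow, inv_one, one_mul] at h3
    have h4 : ‖φ (x - z)‖ * ‖z‖ ≤ S₁ + S₀ * ‖x‖ := by
      have h5 : ‖z‖ ≤ ‖x - z‖ + ‖x‖ := by
        have := _root_.norm_sub_le x (x - z)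
        rw [sub_sub_cancel] at this; linarith
      calc _ ≤ ‖φ (x - z)‖ * (‖x - z‖ + ‖x‖) := by gcongr
        _ = ‖x - z‖ * ‖φ (x - z)‖ + ‖φ (x - z)‖ * ‖x‖ := by ring
        _ ≤ _ := by
          gcongr
          · exact h1 _
          · exact h0 _
    have h6 : ‖(cutoff ‖z‖ : ℂ) * φ x‖ * ‖z‖ ≤ 2 * S₀ := by
      rw [norm_mul, Complex.norm_real, Real.norm_of_nonneg (cutoff_nonneg _)]
      rcases le_or_gt 2 ‖z‖ with h2 | h2
      · rw [cutoff_of_two_le h2]; simp; positivity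
      · calc _ ≤ 1 * S₀ * 2 := by
              gcongr
              · exact cutoff_le_one _
              · exact h0 x
          _ = _ := by ring
    have h7 : ‖φ (x - z) - (cutoff ‖z‖ : ℂ) * φ x‖ ≤ (S₁ + 3 * S₀) * (1 + ‖x‖) * ‖z‖⁻¹ := by
      rw [← div_eq_mul_inv, le_div_iff₀ hz0]
      calc _ ≤ (‖φ (x - z)‖ + ‖(cutoff ‖z‖ : ℂ) * φ x‖) * ‖z‖ := by
            gcongr; exact _root_.norm_sub_le _ _
        _ ≤ S₁ + S₀ * ‖x‖ + 2 * S₀ := by linarith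
        _ ≤ _ := by nlinarith [mul_nonneg hS₁ hx, mul_nonneg hS₀ hx]
    calc _ ≤ (B * (‖z‖ ^ d)⁻¹) * ((S₁ + 3 * S₀) * (1 + ‖x‖) * ‖z‖⁻¹) := by
          gcongr; exact hK.norm_le z
      _ = B * (S₁ + 3 * S₀) * (1 + ‖x‖) * (‖z‖⁻¹ * (‖z‖ ^ d)⁻¹) := by ring
      _ ≤ _ := by gcongr; linarith

theorem CancellingKernel.integrable_pvIntegrand {d : ℕ} [NeZero d] {K : Euc d → ℂ} {B : ℝ}
    (hK : CancellingKernel K B) (φ : 𝓢(Euc d, ℂ)) (x : Euc d) :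
    Integrable (pvIntegrand K φ x) := by
  obtain ⟨A, -, h⟩ := hK.exists_norm_pvIntegrand_le φ
  refine ((integrable_radialMajorant (d := d)).const_mul (A * (1 + ‖x‖))).mono' ?_
    (Eventually.of_forall (h x))
  refine (hK.measurable.mul (Continuous.measurable ?_)).aestronglyMeasurable
  have := continuous_cutoff
  have := φ.continuous
  fun_prop

theorem CancellingKernel.continuousAt_pvIntegrand {d : ℕ} {K : Euc d → ℂ} {B : ℝ}
    (hK : CancellingKernel K B) (φ : 𝓢(Euc d, ℂ)) (x : Euc d) {z : Euc d} (hz : z ≠ 0) :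
    ContinuousAt (pvIntegrand K φ x) z := by
  refine (hK.continuousAt hz).mul (Continuous.continuousAt ?_)
  have := continuous_cutoff
  have := φ.continuous
  fun_prop

theorem ae_ne_zero_euclidean {d : ℕ} [NeZero d] : ∀ᵐ z : Euc d, z ≠ 0 :=
  (measure_eq_zero_iff_ae_notMem (s := {(0 : Euc d)})).1 (measure_singleton 0)

/-- The truncated integrals converge to `pvConv` at every point: the cutoff term integrates to zero
over every region `ε < |z|`. -/
theorem CancellingKernel.tendsto_pvConv {d : ℕ} [NeZero d] {K : Euc d → ℂ} {B : ℝ}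
    (hK : CancellingKernel K B) (φ : 𝓢(Euc d, ℂ)) (x : Euc d) :
    Tendsto (fun ε : ℝ => ∫ y in {y | ε < ‖x - y‖}, K (x - y) * φ y) (𝓝[>] 0)
      (𝓝 (pvConv K φ x)) := by
  have hopen : ∀ ε : ℝ, MeasurableSet {z : Euc d | ε < ‖z‖} := fun ε =>
    measurableSet_lt measurable_const measurable_norm
  have heq : ∀ ε : ℝ, 0 < ε → ∫ y in {y | ε < ‖x - y‖}, K (x - y) * φ y
      = ∫ z, {z : Euc d | ε < ‖z‖}.indicator (pvIntegrand K φ x) z := by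
    intro ε hε
    have hmeas : MeasurableSet {y | ε < ‖x - y‖} :=
      measurableSet_lt measurable_const (by fun_prop)
    let g : ℝ → ℝ := fun r => if ε < r then cutoff r else 0
    have hg : Integrable fun z : Euc d => (‖z‖ ^ d)⁻¹ * g ‖z‖ := by
      have hm : Measurable g :=
        Measurable.ite (measurableSet_lt measurable_const measurable_id)
          continuous_cutoff.measurable measurable_const
      have hb : Integrable ((Metric.closedBall (0 : Euc d) 2).indicator
          fun _ => (ε ^ d)⁻¹) := by
        rw [integrable_indicator_iff Metric.isClosed_closedBall.measurableSet]
        exact integrableOn_const (measure_closedBall_lt_top.ne)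
      refine hb.mono' ?_ (Eventually.of_forall fun z => ?_)
      · exact (Measurable.mul (by fun_prop) (hm.comp measurable_norm)).aestronglyMeasurable
      · by_cases h1 : ε < ‖z‖
        · by_cases h2 : ‖z‖ ≤ 2
          · rw [Set.indicator_of_mem (by simpa using h2)]
            simp only [g, if_pos h1]
            rw [norm_mul, Real.norm_of_nonneg (cutoff_nonneg _),
              Real.norm_of_nonneg (by positivity)]
            refine (mul_le_of_le_one_right (by positivity) (cutoff_le_one _)).trans ?_
            gcongr
          · rw [Set.indicator_of_notMem (by simpa using h2)]
            simp [g, if_pos h1, cutoff_of_two_le (not_le.1 h2).le]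
        · simp only [g, if_neg h1, mul_zero, norm_zero]
          exact Set.indicator_nonneg (fun _ _ => by positivity) _
    have hKg : Integrable fun z => K z * (g ‖z‖ : ℂ) := by
      have hm : Measurable g :=
        Measurable.ite (measurableSet_lt measurable_const measurable_id)
          continuous_cutoff.measurable measurable_const
      refine (hg.const_mul B).mono' ?_ (Eventually.of_forall fun z => ?_)
      · exact (hK.measurable.mul (Complex.measurable_ofReal.comp
          (hm.comp measurable_norm))).aestronglyMeasurable
      · have hg0 : 0 ≤ g ‖z‖ := by
          simp only [g]; split_ifs
          · exact cutoff_nonneg _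
          · exact le_rfl
        rw [norm_mul, Complex.norm_real, Real.norm_of_nonneg hg0, ← mul_assoc]
        gcongr
        exact hK.norm_le z
    have h0 := hK.integral_radial g hg
    calc ∫ y in {y | ε < ‖x - y‖}, K (x - y) * φ y
        = ∫ y, (fun z => {z : Euc d | ε < ‖z‖}.indicator (fun z => K z * φ (x - z)) z) (x - y) := by
          rw [← integral_indicator hmeas]
          congr 1; ext y
          by_cases h : ε < ‖x - y‖
          · have h1 : x - y ∈ {z : Euc d | ε < ‖z‖} := h
            have h2 : y ∈ {y | ε < ‖x - y‖} := h
            simp only [Set.indicator_of_mem h1, Set.indicator_of_mem h2, sub_sub_cancel]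
          · have h1 : x - y ∉ {z : Euc d | ε < ‖z‖} := h
            have h2 : y ∉ {y | ε < ‖x - y‖} := h
            simp only [Set.indicator_of_notMem h1, Set.indicator_of_notMem h2]
      _ = ∫ z, {z : Euc d | ε < ‖z‖}.indicator (fun z => K z * φ (x - z)) z :=
          integral_sub_left_eq_self _ volume x
      _ = ∫ z, ({z : Euc d | ε < ‖z‖}.indicator (pvIntegrand K φ x) z
            + φ x * (K z * (g ‖z‖ : ℂ))) := by
          congr 1; ext z
          by_cases h : ε < ‖z‖
          · rw [Set.indicator_of_mem (by exact h), Set.indicator_of_mem (by exact h)]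
            simp only [g, if_pos h, pvIntegrand]; ring
          · rw [Set.indicator_of_notMem (by exact h), Set.indicator_of_notMem (by exact h)]
            simp [g, if_neg h]
      _ = _ := by
          rw [integral_add ((hK.integrable_pvIntegrand φ x).indicator (hopen ε))
            (hKg.const_mul _), integral_const_mul, h0, mul_zero, add_zero]
  have hlim : Tendsto (fun ε : ℝ => ∫ z, {z : Euc d | ε < ‖z‖}.indicator (pvIntegrand K φ x) z)
      (𝓝[>] 0) (𝓝 (pvConv K φ x)) := by
    refine tendsto_integral_filter_of_dominated_convergence (fun z => ‖pvIntegrand K φ x z‖)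
      (Eventually.of_forall fun ε =>
        ((hK.integrable_pvIntegrand φ x).indicator (hopen ε)).aestronglyMeasurable)
      (Eventually.of_forall fun ε => Eventually.of_forall fun z => norm_indicator_le_norm_self _ _)
      (hK.integrable_pvIntegrand φ x).norm ?_
    filter_upwards [ae_ne_zero_euclidean] with z hz
    refine tendsto_const_nhds.congr' ?_
    filter_upwards [Ioo_mem_nhdsGT (norm_pos_iff.2 hz)] with ε hε
    rw [Set.indicator_of_mem (by exact hε.2)]
  refine hlim.congr' ?_
  filter_upwards [self_mem_nhdsWithin] with ε hε using (heq ε hε).symm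

/-! ### Lattice approximation of the principal value operator -/

/-- The convolution of `φ` with the kernel restricted to the lattice `N⁻¹ ℤ^d`. -/
noncomputable def latticeConv {d : ℕ} (K : Euc d → ℂ) (N : ℕ) (φ : 𝓢(Euc d, ℂ)) (x : Euc d) : ℂ :=
  ∑' k : Fin d → ℤ, K (latticePoint k) * φ (x - scaledPoint N k)

theorem CancellingKernel.apply_latticePoint {d : ℕ} {K : Euc d → ℂ} {B : ℝ}
    (hK : CancellingKernel K B) {N : ℕ} (hN : 1 ≤ N) (k : Fin d → ℤ) :
    K (latticePoint k) = ((N : ℂ) ^ d)⁻¹ * K (scaledPoint N k) := by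
  have hN' : (0 : ℝ) < N := by positivity
  have h := hK.map_smul N hN' (scaledPoint N k)
  rw [scaledPoint, smul_inv_smul₀ hN'.ne'] at h
  rw [h, scaledPoint, Complex.ofReal_natCast]

theorem CancellingKernel.latticeConv_summand {d : ℕ} {K : Euc d → ℂ} {B : ℝ}
    (hK : CancellingKernel K B) {N : ℕ} (hN : 1 ≤ N) (φ : 𝓢(Euc d, ℂ)) (x : Euc d)
    (k : Fin d → ℤ) :
    K (latticePoint k) * φ (x - scaledPoint N k)
      = ((N : ℂ) ^ d)⁻¹ * pvIntegrand K φ x (scaledPoint N k) + nearKernel K N k * φ x := by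
  rw [nearKernel, hK.apply_latticePoint hN, pvIntegrand]; ring

/-- The lattice convolution is a Riemann sum of the regularized integrand, because the subtracted
term sums to zero on the lattice. -/
theorem CancellingKernel.hasSum_latticeConv {d : ℕ} [NeZero d] {K : Euc d → ℂ} {B : ℝ}
    (hK : CancellingKernel K B) {N : ℕ} (hN : 1 ≤ N) (φ : 𝓢(Euc d, ℂ)) (x : Euc d) :
    HasSum (fun k => K (latticePoint k) * φ (x - scaledPoint N k)) (latticeConv K N φ x) ∧
      latticeConv K N φ x = ∑' k, ((N : ℂ) ^ d)⁻¹ * pvIntegrand K φ x (scaledPoint N k) := by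
  obtain ⟨A, hA, hle⟩ := hK.exists_norm_pvIntegrand_le φ
  obtain ⟨C, hC, hs⟩ := exists_tsum_radialMajorant_le d
  have h1 : Summable fun k => ((N : ℂ) ^ d)⁻¹ * pvIntegrand K φ x (scaledPoint N k) := by
    refine Summable.of_norm_bounded ((hs N hN).1.mul_left (A * (1 + ‖x‖))) fun k => ?_
    rw [norm_mul, norm_inv, norm_pow, Complex.norm_natCast]
    calc _ ≤ ((N : ℝ) ^ d)⁻¹ * (A * (1 + ‖x‖) * radialMajorant d ‖scaledPoint N k‖) := by
          gcongr; exact hle _ _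
      _ = _ := by ring
  have h2 : Summable fun k => nearKernel K N k :=
    summable_of_hasFiniteSupport (support_nearKernel_finite K hN)
  have h3 : (fun k => K (latticePoint k) * φ (x - scaledPoint N k)) = fun k =>
      ((N : ℂ) ^ d)⁻¹ * pvIntegrand K φ x (scaledPoint N k) + nearKernel K N k * φ x := by
    ext k; exact hK.latticeConv_summand hN φ x k
  refine ⟨?_, ?_⟩
  · refine Summable.hasSum ?_
    rw [h3]
    exact h1.add (h2.mul_right _)
  · rw [latticeConv, h3, h1.tsum_add (h2.mul_right _), tsum_mul_right, hK.tsum_nearKernel hN,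
      zero_mul, add_zero]

theorem CancellingKernel.exists_norm_latticeConv_le {d : ℕ} [NeZero d] {K : Euc d → ℂ} {B : ℝ}
    (hK : CancellingKernel K B) (φ : 𝓢(Euc d, ℂ)) :
    ∃ A : ℝ, 0 ≤ A ∧ ∀ N : ℕ, 1 ≤ N → ∀ x, ‖latticeConv K N φ x‖ ≤ A * (1 + ‖x‖) := by
  obtain ⟨A, hA, hle⟩ := hK.exists_norm_pvIntegrand_le φ
  obtain ⟨C, hC, hs⟩ := exists_tsum_radialMajorant_le d
  refine ⟨A * C, by positivity, fun N hN x => ?_⟩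
  rw [(hK.hasSum_latticeConv hN φ x).2]
  refine (tsum_of_norm_bounded ((hs N hN).1.mul_left (A * (1 + ‖x‖))).hasSum fun k => ?_).trans ?_
  · rw [norm_mul, norm_inv, norm_pow, Complex.norm_natCast]
    calc _ ≤ ((N : ℝ) ^ d)⁻¹ * (A * (1 + ‖x‖) * radialMajorant d ‖scaledPoint N k‖) := by
          gcongr; exact hle _ _
      _ = _ := by ring
  · rw [tsum_mul_left]
    calc _ ≤ A * (1 + ‖x‖) * C := by gcongr; exact (hs N hN).2
      _ = _ := by ring

theorem CancellingKernel.tendsto_latticeConv {d : ℕ} [NeZero d] {K : Euc d → ℂ} {B : ℝ}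
    (hK : CancellingKernel K B) (φ : 𝓢(Euc d, ℂ)) (x : Euc d) :
    Tendsto (fun N : ℕ => latticeConv K N φ x) atTop (𝓝 (pvConv K φ x)) := by
  obtain ⟨A, hA, hle⟩ := hK.exists_norm_pvIntegrand_le φ
  refine (tendsto_riemannSum (A := A * (1 + ‖x‖)) (by positivity)
    (fun z hz => hK.continuousAt_pvIntegrand φ x hz) (hle x)).congr' ?_
  filter_upwards [eventually_ge_atTop 1] with N hN
  rw [(hK.hasSum_latticeConv hN φ x).2]

theorem measurable_latticeConv {d : ℕ} [NeZero d] {K : Euc d → ℂ} {B : ℝ}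
    (hK : CancellingKernel K B) {N : ℕ} (hN : 1 ≤ N) (φ : 𝓢(Euc d, ℂ)) :
    Measurable (latticeConv K N φ) := by
  refine measurable_of_tendsto_metrizable' atTop
    (f := fun (s : Finset (Fin d → ℤ)) x =>
      ∑ k ∈ s, K (latticePoint k) * φ (x - scaledPoint N k)) (fun s => ?_)
    (tendsto_pi_nhds.2 fun x => (hK.hasSum_latticeConv hN φ x).1)
  refine Continuous.measurable ?_
  have := φ.continuous
  fun_prop

theorem CancellingKernel.measurable_pvConv {d : ℕ} [NeZero d] {K : Euc d → ℂ} {B : ℝ}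
    (hK : CancellingKernel K B) (φ : 𝓢(Euc d, ℂ)) : Measurable (pvConv K φ) := by
  refine measurable_of_tendsto_metrizable
    (f := fun N : ℕ => latticeConv K (N + 1) φ) (fun N => measurable_latticeConv hK (by omega) φ)
    (tendsto_pi_nhds.2 fun x => (tendsto_add_atTop_iff_nat 1).2 (hK.tendsto_latticeConv φ x))

/-- The values of a Schwartz function on a shifted lattice, as a square-summable sequence. -/
theorem SchwartzMap.memℓp_lattice {d : ℕ} [NeZero d] (φ : 𝓢(Euc d, ℂ)) {N : ℕ} (hN : 1 ≤ N)
    (x : Euc d) : Memℓp (fun k : Fin d → ℤ => φ (scaledPoint N k + x)) 2 := by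
  have hN' : (0 : ℝ) < N := by positivity
  have hN1 : (1 : ℝ) ≤ N := by exact_mod_cast hN
  suffices h : Summable fun k : Fin d → ℤ => ‖φ (scaledPoint N k + x)‖ by
    refine Memℓp.of_exponent_ge (p := 2) (q := 1) (memℓp_gen ?_) one_le_two
    simpa using h
  obtain ⟨C, -, hs⟩ := exists_tsum_radialMajorant_le d
  obtain ⟨S₀, hS₀, h0⟩ := φ.exists_norm_le 0
  obtain ⟨S₁, hS₁, h1⟩ := φ.exists_norm_le (d + 1)
  simp only [pow_zero, one_mul] at h0
  have h2 := (hs N hN).1.mul_left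
    ((2 ^ d * (S₁ + ‖x‖ ^ (d + 1) * S₀)) * (((N : ℝ)⁻¹ ^ 2)⁻¹ * (N : ℝ) ^ d))
  refine h2.of_norm_bounded_eventually ?_
  refine (Set.finite_singleton (0 : Fin d → ℤ)).subset fun k hk => ?_
  by_contra hk0
  refine hk ?_
  have hz : (N : ℝ)⁻¹ ≤ ‖scaledPoint N k‖ := by
    rw [norm_scaledPoint]
    exact le_mul_of_one_le_right (by positivity) (one_le_norm_latticePoint hk0)
  have hz0 : 0 < ‖scaledPoint N k‖ := (inv_pos.2 hN').trans_le hz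
  have h3 := inv_mul_inv_pow_le_radialMajorant (d := d) (inv_pos.2 hN')
    (inv_le_one_of_one_le₀ hN1) hz
  set z := scaledPoint N k
  have h4 : ‖z‖ ^ (d + 1) * ‖φ (z + x)‖ ≤ 2 ^ d * (S₁ + ‖x‖ ^ (d + 1) * S₀) := by
    have h5 : ‖z‖ ≤ ‖z + x‖ + ‖x‖ := by
      have := norm_sub_le (z + x) x
      rwa [add_sub_cancel_right] at this
    have h6 := add_pow_le (norm_nonneg (z + x)) (norm_nonneg x) (d + 1)
    calc _ ≤ (‖z + x‖ + ‖x‖) ^ (d + 1) * ‖φ (z + x)‖ := by gcongr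
      _ ≤ 2 ^ d * (‖z + x‖ ^ (d + 1) + ‖x‖ ^ (d + 1)) * ‖φ (z + x)‖ := by gcongr; exact h6
      _ = 2 ^ d * (‖z + x‖ ^ (d + 1) * ‖φ (z + x)‖ + ‖x‖ ^ (d + 1) * ‖φ (z + x)‖) := by ring
      _ ≤ _ := by
        gcongr
        · exact h1 _
        · exact h0 _
  change ‖‖φ (z + x)‖‖ ≤ _
  rw [norm_norm]
  calc ‖φ (z + x)‖ = (‖z‖ ^ (d + 1) * ‖φ (z + x)‖) * (‖z‖⁻¹ * (‖z‖ ^ d)⁻¹) := by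
        rw [pow_succ]; field_simp
    _ ≤ (2 ^ d * (S₁ + ‖x‖ ^ (d + 1) * S₀)) * (((N : ℝ)⁻¹ ^ 2)⁻¹ * radialMajorant d ‖z‖) := by
        gcongr
    _ = (2 ^ d * (S₁ + ‖x‖ ^ (d + 1) * S₀)) * (((N : ℝ)⁻¹ ^ 2)⁻¹ * (N : ℝ) ^ d) *
          (((N : ℝ) ^ d)⁻¹ * radialMajorant d ‖z‖) := by field_simp

/-! ### The bounded extension to square-integrable functions -/

/-- The samples `φ(x + k/N)`, `k ∈ ℤ^d`, as an element of `ℓ²(ℤ^d)`. -/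
noncomputable def latticeSamples {d : ℕ} [NeZero d] (φ : 𝓢(Euc d, ℂ)) {N : ℕ} (hN : 1 ≤ N)
    (x : Euc d) : lp (fun _ : Fin d → ℤ => ℂ) 2 :=
  ⟨fun k => φ (scaledPoint N k + x), φ.memℓp_lattice hN x⟩

theorem latticeSamples_apply {d : ℕ} [NeZero d] (φ : 𝓢(Euc d, ℂ)) {N : ℕ} (hN : 1 ≤ N)
    (x : Euc d) (k : Fin d → ℤ) : latticeSamples φ hN x k = φ (scaledPoint N k + x) := rfl

/-- On samples, the lattice convolution acts as the Toeplitz matrix of the kernel. -/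
theorem CancellingKernel.toeplitz_latticeSamples {d : ℕ} [NeZero d] {K : Euc d → ℂ} {B : ℝ}
    (hK : CancellingKernel K B)
    {T : lp (fun _ : Fin d → ℤ => ℂ) 2 →L[ℂ] lp (fun _ : Fin d → ℤ => ℂ) 2}
    (hT : ∀ U m, HasSum (fun n => K (latticePoint (m - n)) * U n) (T U m))
    {N : ℕ} (hN : 1 ≤ N) (φ : 𝓢(Euc d, ℂ)) (x : Euc d) (m : Fin d → ℤ) :
    T (latticeSamples φ hN x) m = latticeConv K N φ (scaledPoint N m + x) := by
  refine (hT _ m).unique ?_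
  rw [← (Equiv.subLeft m).hasSum_iff]
  refine (hK.hasSum_latticeConv hN φ (scaledPoint N m + x)).1.congr_fun fun k => ?_
  have h : scaledPoint N (m - k) + x = scaledPoint N m + x - scaledPoint N k := by
    rw [scaledPoint, latticePoint_sub, smul_sub, ← scaledPoint, ← scaledPoint]; abel
  simp only [Function.comp, Equiv.subLeft_apply, sub_sub_cancel, latticeSamples_apply, h]

theorem tsum_enorm_sq_lp {ι : Type*} (U : lp (fun _ : ι => ℂ) 2) :
    ∑' m, ‖U m‖ₑ ^ 2 = ‖U‖ₑ ^ 2 := by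
  have h := lp.hasSum_norm (p := 2) (by norm_num) U
  simp only [ENNReal.toReal_ofNat, Real.rpow_ofNat] at h
  rw [← ofReal_norm, ← ENNReal.ofReal_pow (norm_nonneg _), ← h.tsum_eq,
    ENNReal.ofReal_tsum_of_nonneg (fun _ => by positivity) h.summable]
  congr 1; ext m
  rw [← ofReal_norm, ← ENNReal.ofReal_pow (norm_nonneg _)]

theorem eLpNorm_two_sq {α : Type*} [MeasurableSpace α] {μ : Measure α} (f : α → ℂ) :
    eLpNorm f 2 μ ^ 2 = ∫⁻ x, ‖f x‖ₑ ^ 2 ∂μ := by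
  have h := eLpNorm_nnreal_pow_eq_lintegral (μ := μ) (f := f) (p := 2) two_ne_zero
  simpa using h

/-- The lattice convolutions are bounded on `L²` uniformly in `N`. -/
theorem CancellingKernel.eLpNorm_latticeConv_le {d : ℕ} [NeZero d] {K : Euc d → ℂ} {B : ℝ}
    (hK : CancellingKernel K B)
    {T : lp (fun _ : Fin d → ℤ => ℂ) 2 →L[ℂ] lp (fun _ : Fin d → ℤ => ℂ) 2}
    (hT : ∀ U m, HasSum (fun n => K (latticePoint (m - n)) * U n) (T U m)) {M : ℝ} (hM : 0 ≤ M)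
    (hTM : ∀ U, ‖T U‖ ≤ M * ‖U‖)
    {N : ℕ} (hN : 1 ≤ N) (φ : 𝓢(Euc d, ℂ)) :
    eLpNorm (latticeConv K N φ) 2 volume ≤ ENNReal.ofReal M * eLpNorm φ 2 volume := by
  have hmφ : Measurable φ := φ.continuous.measurable
  rw [← ENNReal.pow_le_pow_left_iff two_ne_zero, mul_pow, eLpNorm_two_sq, eLpNorm_two_sq,
    lintegral_eq_lintegral_tsum hN ((measurable_latticeConv hK hN φ).enorm.pow_const 2),
    lintegral_eq_lintegral_tsum hN (hmφ.enorm.pow_const 2), ← lintegral_const_mul' _ _ (by simp)]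
  refine lintegral_mono fun x => ?_
  have h1 := tsum_enorm_sq_lp (T (latticeSamples φ hN x))
  have h2 := tsum_enorm_sq_lp (latticeSamples φ hN x)
  simp only [hK.toeplitz_latticeSamples hT hN] at h1
  simp only [latticeSamples_apply] at h2
  simp only [h1, h2]
  rw [← mul_pow]
  gcongr
  rw [← ofReal_norm, ← ofReal_norm, ← ENNReal.ofReal_mul hM]
  exact ENNReal.ofReal_le_ofReal (hTM _)

/-- The uniform bound for the lattice convolutions passes to the limit by Fatou's lemma. -/
theorem CancellingKernel.eLpNorm_pvConv_le {d : ℕ} [NeZero d] {K : Euc d → ℂ} {B : ℝ}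
    (hK : CancellingKernel K B)
    {T : lp (fun _ : Fin d → ℤ => ℂ) 2 →L[ℂ] lp (fun _ : Fin d → ℤ => ℂ) 2}
    (hT : ∀ U m, HasSum (fun n => K (latticePoint (m - n)) * U n) (T U m)) {M : ℝ} (hM : 0 ≤ M)
    (hTM : ∀ U, ‖T U‖ ≤ M * ‖U‖) (φ : 𝓢(Euc d, ℂ)) :
    eLpNorm (pvConv K φ) 2 volume ≤ ENNReal.ofReal M * eLpNorm φ 2 volume := by
  refine (Lp.eLpNorm_lim_le_liminf_eLpNorm (f := fun N : ℕ => latticeConv K (N + 1) φ)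
    (fun N => (measurable_latticeConv hK (by omega) φ).aestronglyMeasurable) _
    (Eventually.of_forall fun x =>
      (tendsto_add_atTop_iff_nat 1).2 (hK.tendsto_latticeConv φ x))).trans ?_
  refine (liminf_le_liminf (v := fun _ => ENNReal.ofReal M * eLpNorm φ 2 volume)
    (Eventually.of_forall fun N =>
      hK.eLpNorm_latticeConv_le hT hM hTM (by omega) φ)).trans (le_of_eq ?_)
  exact liminf_const _

theorem integrable_norm_mul_one_add_norm {d : ℕ} (φ : 𝓢(Euc d, ℂ)) :
    Integrable fun x : Euc d => ‖φ x‖ * (1 + ‖x‖) := by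
  refine (φ.integrable.norm.add (φ.integrable_pow_mul volume 1)).congr
    (Eventually.of_forall fun x => ?_)
  simp only [Pi.add_apply, pow_one]; ring

theorem integrable_norm_sq {d : ℕ} (φ : 𝓢(Euc d, ℂ)) :
    Integrable fun x : Euc d => ‖φ x‖ ^ 2 :=
  (memLp_two_iff_integrable_sq_norm φ.continuous.aestronglyMeasurable).1 (φ.memLp 2)

/-- Affine bounds for the quadratic form of the Toeplitz matrix pass to the principal value
operator. -/
theorem CancellingKernel.map_integral_pvConv_le {d : ℕ} [NeZero d] {K : Euc d → ℂ} {B : ℝ}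
    (hK : CancellingKernel K B)
    {T : lp (fun _ : Fin d → ℤ => ℂ) 2 →L[ℂ] lp (fun _ : Fin d → ℤ => ℂ) 2}
    (hT : ∀ U m, HasSum (fun n => K (latticePoint (m - n)) * U n) (T U m))
    {l : ℂ →L[ℝ] ℝ} {s : ℝ} (hl : ∀ U, l (inner ℂ U (T U)) ≤ s * ‖U‖ ^ 2) (φ : 𝓢(Euc d, ℂ)) :
    l (∫ x, inner ℂ (φ x) (pvConv K φ x)) ≤ s * ∫ x, ‖φ x‖ ^ 2 := by
  obtain ⟨A, hA, hle⟩ := hK.exists_norm_latticeConv_le φ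
  have hmφ : Measurable φ := φ.continuous.measurable
  have hdom : Integrable fun x : Euc d => A * (‖φ x‖ * (1 + ‖x‖)) :=
    (integrable_norm_mul_one_add_norm φ).const_mul A
  have hbd : ∀ N : ℕ, 1 ≤ N → ∀ x, ‖(inner ℂ (φ x) (latticeConv K N φ x) : ℂ)‖
      ≤ A * (‖φ x‖ * (1 + ‖x‖)) := by
    intro N hN x
    refine (norm_inner_le_norm _ _).trans ?_
    calc _ ≤ ‖φ x‖ * (A * (1 + ‖x‖)) := by gcongr; exact hle N hN x
      _ = _ := by ring
  have hmeas : ∀ N : ℕ, 1 ≤ N → AEStronglyMeasurable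
      (fun x => (inner ℂ (φ x) (latticeConv K N φ x) : ℂ)) volume := fun N hN =>
    hmφ.aestronglyMeasurable.inner (measurable_latticeConv hK hN φ).aestronglyMeasurable
  have hint : ∀ N : ℕ, 1 ≤ N →
      Integrable fun x => (inner ℂ (φ x) (latticeConv K N φ x) : ℂ) := fun N hN =>
    hdom.mono' (hmeas N hN) (Eventually.of_forall (hbd N hN))
  have hlim : Tendsto (fun N : ℕ => ∫ x, (inner ℂ (φ x) (latticeConv K N φ x) : ℂ)) atTop
      (𝓝 (∫ x, inner ℂ (φ x) (pvConv K φ x))) := by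
    refine tendsto_integral_filter_of_dominated_convergence _
      ((eventually_ge_atTop 1).mono hmeas)
      ((eventually_ge_atTop 1).mono fun N hN => Eventually.of_forall (hbd N hN)) hdom
      (Eventually.of_forall fun x => ?_)
    exact tendsto_const_nhds.inner (hK.tendsto_latticeConv φ x)
  refine le_of_tendsto (l.continuous.tendsto _ |>.comp hlim) ?_
  filter_upwards [eventually_ge_atTop 1] with N hN
  have hi1 := (integrable_norm_sq φ).const_mul s
  have hi2 := l.integrable_comp (hint N hN)
  have key : 0 ≤ ∫ x, (s * ‖φ x‖ ^ 2 - l (inner ℂ (φ x) (latticeConv K N φ x))) := by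
    refine integral_nonneg_of_tsum_nonneg hN (hi1.sub hi2) fun x => ?_
    set U := latticeSamples φ hN x
    have h1 := lp.hasSum_norm (p := 2) (by norm_num) U
    simp only [ENNReal.toReal_ofNat, Real.rpow_ofNat] at h1
    have h2 := l.hasSum (lp.hasSum_inner U (T U))
    have h3 := (h1.mul_left s).sub h2
    have h4 : ∀ k, s * ‖U k‖ ^ 2 - l (inner ℂ (U k) (T U k))
        = s * ‖φ (scaledPoint N k + x)‖ ^ 2 - l (inner ℂ (φ (scaledPoint N k + x))
          (latticeConv K N φ (scaledPoint N k + x))) := by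
      intro k
      rw [hK.toeplitz_latticeSamples hT hN, latticeSamples_apply]
    simp only [h4] at h3
    rw [h3.tsum_eq]
    linarith [hl U]
  rw [integral_sub hi1 hi2, integral_const_mul, l.integral_comp_comm (hint N hN)] at key
  simp only [Function.comp]
  linarith

/-- The principal value convolution as a linear map from Schwartz functions to `L²`, bounded for the
`L²` norm. -/
theorem CancellingKernel.exists_linearMap_pvConv {d : ℕ} [NeZero d] {K : Euc d → ℂ} {B : ℝ}
    (hK : CancellingKernel K B)
    {T : lp (fun _ : Fin d → ℤ => ℂ) 2 →L[ℂ] lp (fun _ : Fin d → ℤ => ℂ) 2}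
    (hT : ∀ U m, HasSum (fun n => K (latticePoint (m - n)) * U n) (T U m)) {M : ℝ} (hM : 0 ≤ M)
    (hTM : ∀ U, ‖T U‖ ≤ M * ‖U‖) :
    ∃ S : 𝓢(Euc d, ℂ) →ₗ[ℂ] L2Space d, (∀ φ, S φ =ᵐ[volume] pvConv K φ) ∧
      ∀ φ, ‖S φ‖ ≤ M * ‖φ.toLp 2 (volume : Measure (Euc d))‖ := by
  have hmem : ∀ φ : 𝓢(Euc d, ℂ), MemLp (pvConv K φ) 2 volume := fun φ =>
    ⟨(hK.measurable_pvConv φ).aestronglyMeasurable,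
      (hK.eLpNorm_pvConv_le hT hM hTM φ).trans_lt
        (ENNReal.mul_lt_top ENNReal.ofReal_lt_top (φ.memLp 2 volume).eLpNorm_lt_top)⟩
  have hadd : ∀ φ ψ, pvConv K (φ + ψ) = pvConv K φ + pvConv K ψ := fun φ ψ => by
    ext x
    simp only [pvConv, Pi.add_apply]
    rw [← integral_add (hK.integrable_pvIntegrand φ x) (hK.integrable_pvIntegrand ψ x)]
    congr 1; ext z
    simp only [pvIntegrand, add_apply]; ring
  have hsmul : ∀ (c : ℂ) φ, pvConv K (c • φ) = c • pvConv K φ := fun c φ => by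
    ext x
    simp only [pvConv, Pi.smul_apply]
    rw [← integral_smul]
    congr 1; ext z
    simp only [pvIntegrand, smul_apply, smul_eq_mul]; ring
  refine ⟨
    { toFun := fun φ => (hmem φ).toLp
      map_add' := fun φ ψ => by
        rw [← MemLp.toLp_add]
        exact MemLp.toLp_congr _ _ (by rw [hadd])
      map_smul' := fun c φ => by
        rw [RingHom.id_apply, ← MemLp.toLp_const_smul]
        exact MemLp.toLp_congr _ _ (by rw [hsmul]) }, fun φ => (hmem φ).coeFn_toLp, fun φ => ?_⟩
  rw [SchwartzMap.norm_toLp]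
  change ‖(hmem φ).toLp‖ ≤ _
  rw [Lp.norm_toLp]
  have h := hK.eLpNorm_pvConv_le hT hM hTM φ
  have h2 := ENNReal.toReal_mono
    (ENNReal.mul_ne_top ENNReal.ofReal_ne_top (φ.memLp 2 volume).eLpNorm_ne_top) h
  rwa [ENNReal.toReal_mul, ENNReal.toReal_ofReal hM] at h2

/-- Principal value convolution with `K` extends to a unique bounded operator on `L²(ℝ^d)`, whose
quadratic form obeys every affine bound satisfied by the symbol. -/
theorem CancellingKernel.exists_isPVConvolution {d : ℕ} [NeZero d] {K : Euc d → ℂ} {B : ℝ}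
    (hK : CancellingKernel K B) :
    ∃ A : L2Space d →L[ℂ] L2Space d, IsPVConvolution K A ∧
      (∀ A' : L2Space d →L[ℂ] L2Space d, IsPVConvolution K A' → A' = A) ∧
      ∀ (l : ℂ →L[ℝ] ℝ) (s : ℝ), (∀ t, t ≠ 0 → l (torusSymbol K t) ≤ s) →
        ∀ u, l (inner ℂ u (A u)) ≤ s * ‖u‖ ^ 2 := by
  obtain ⟨M, hM, hTex⟩ := hK.exists_toeplitz
  obtain ⟨T, hT, hTM, hTl⟩ := hTex (Fin d → ℤ) id Function.injective_id
  obtain ⟨S, hS, hSM⟩ := hK.exists_linearMap_pvConv (T := T) hT hM hTM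
  let j : 𝓢(Euc d, ℂ) →ₗ[ℂ] L2Space d :=
    (SchwartzMap.toLpCLM ℂ ℂ 2 (volume : Measure (Euc d))).toLinearMap
  have hdense : DenseRange fun φ : 𝓢(Euc d, ℂ) => φ.toLp 2 (volume : Measure (Euc d)) :=
    SchwartzMap.denseRange_toLpCLM (F := ℂ) (μ := (volume : Measure (Euc d)))
      (p := 2) ENNReal.ofNat_ne_top
  obtain ⟨A, hA⟩ : ∃ A : L2Space d →L[ℂ] L2Space d, ∀ φ : 𝓢(Euc d, ℂ), A (φ.toLp 2) = S φ :=
    ⟨S.extendOfNorm j, fun φ => S.extendOfNorm_eq (e := j) hdense ⟨M, hSM⟩ φ⟩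
  refine ⟨A, fun φ => ?_, fun A' hA' => ?_, fun l s hls u => ?_⟩
  · rw [hA]
    filter_upwards [hS φ] with x hx
    rw [hx]
    exact hK.tendsto_pvConv φ x
  · refine ContinuousLinearMap.ext fun u => ?_
    refine hdense.induction_on (p := fun u => A' u = A u) u
      (isClosed_eq A'.continuous A.continuous) fun φ => ?_
    rw [hA]
    apply Lp.ext
    filter_upwards [hS φ, hA' φ] with x h1 h2
    rw [h1]
    exact tendsto_nhds_unique h2 (hK.tendsto_pvConv φ x)
  · refine hdense.induction_on (p := fun u => l (inner ℂ u (A u)) ≤ s * ‖u‖ ^ 2) u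
      (isClosed_le (l.continuous.comp (continuous_id.inner A.continuous))
        (continuous_const.mul (continuous_norm.pow 2))) fun φ => ?_
    have h1 : (inner ℂ (φ.toLp 2 : L2Space d) (S φ) : ℂ)
        = ∫ x, inner ℂ (φ x) (pvConv K φ x) := by
      rw [L2.inner_def]
      refine integral_congr_ae ?_
      filter_upwards [φ.coeFn_toLp 2 (volume : Measure (Euc d)), hS φ] with x e1 e2
      rw [e1, e2]
    have h2 : ‖(φ.toLp 2 : L2Space d)‖ ^ 2 = ∫ x, ‖φ x‖ ^ 2 := by
      rw [← inner_self_eq_norm_sq (𝕜 := ℂ), L2.inner_def,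
        ← integral_re (L2.integrable_inner _ _)]
      refine integral_congr_ae ?_
      filter_upwards [φ.coeFn_toLp 2 (volume : Measure (Euc d))] with x e1
      rw [inner_self_eq_norm_sq, e1]
    rw [hA, h1, h2]
    exact hK.map_integral_pvConv_le hT (hTl l s hls) φ

/-! ### From the torus to the period cube -/

/-- The covering of the torus `(ℝ/ℤ)^d` by `ℝ^d` with period `2π` in each variable. -/
noncomputable def torusCover {d : ℕ} (τ : Euc d) : UnitAddTorus (Fin d) :=
  fun i => (((2 * Real.pi)⁻¹ * τ i : ℝ) : UnitAddCircle)

theorem continuous_torusCover {d : ℕ} : Continuous (torusCover : Euc d → UnitAddTorus (Fin d)) :=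
  continuous_pi fun i => (AddCircle.continuous_mk' 1).comp (by fun_prop)

theorem mFourier_torusCover {d : ℕ} (m : Fin d → ℤ) (τ : Euc d) :
    UnitAddTorus.mFourier m (torusCover τ)
      = Complex.exp (Complex.I * ((inner ℝ (latticePoint m) τ : ℝ) : ℂ)) := by
  simp only [UnitAddTorus.mFourier, ContinuousMap.coe_mk, torusCover, fourier_coe_apply]
  rw [← Complex.exp_sum]
  congr 1
  rw [PiLp.inner_apply, Complex.ofReal_sum, Finset.mul_sum]
  refine Finset.sum_congr rfl fun i _ => ?_
  have hπ : (Real.pi : ℂ) ≠ 0 := by exact_mod_cast Real.pi_ne_zero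
  simp only [latticePoint_apply, RCLike.inner_apply, conj_trivial]
  push_cast
  field_simp

theorem torusCover_ne_zero {d : ℕ} {τ : Euc d} (hτ : τ ∈ periodCube d) (h0 : τ ≠ 0) :
    torusCover τ ≠ 0 := by
  intro h
  refine h0 ?_
  ext i
  have hi : ((((2 * Real.pi)⁻¹ * τ i : ℝ)) : UnitAddCircle) = 0 := congrFun h i
  obtain ⟨n, hn⟩ := (AddCircle.coe_eq_zero_iff 1).1 hi
  have hτi := hτ i
  have hπ := Real.pi_pos
  have hn' : τ i = 2 * Real.pi * n := by
    have : (n : ℝ) = (2 * Real.pi)⁻¹ * τ i := by simpa using hn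
    rw [this]; field_simp
  have hlt : |(n : ℝ)| < 1 := by
    rw [abs_lt]
    constructor <;> nlinarith [hτi.1, hτi.2]
  have hn0 : n = 0 := by
    rw [← Int.abs_lt_one_iff]; exact_mod_cast hlt
  rw [hn', hn0]; simp

/-- Every nonzero point of the torus has a representative in the period cube, obtained by rounding
each coordinate. -/
theorem exists_torusCover_eq {d : ℕ} {t : UnitAddTorus (Fin d)} (ht : t ≠ 0) :
    ∃ τ ∈ periodCube d \ {0}, torusCover τ = t := by
  have hπ := Real.pi_pos
  choose x hx using fun i => QuotientAddGroup.mk_surjective (t i)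
  let τ : Euc d := WithLp.toLp 2 fun i => 2 * Real.pi * (x i - round (x i))
  have hτ : ∀ i, τ i = 2 * Real.pi * (x i - round (x i)) := fun i => rfl
  have hmap : torusCover τ = t := by
    ext i
    have h1 : (2 * Real.pi)⁻¹ * τ i = x i - round (x i) := by rw [hτ]; field_simp
    have h2 : (((round (x i) : ℤ) : ℝ) : UnitAddCircle) = 0 :=
      (AddCircle.coe_eq_zero_iff 1).2 ⟨round (x i), by simp⟩
    rw [torusCover, h1, AddCircle.coe_sub, h2, sub_zero]
    exact hx i
  refine ⟨τ, ⟨fun i => ?_, fun h => ?_⟩, hmap⟩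
  · have h := abs_le.1 (abs_sub_round (x i))
    rw [hτ]
    constructor <;> nlinarith [h.1, h.2]
  · refine ht ?_
    rw [← hmap, Set.mem_singleton_iff.1 h]
    ext i; simp [torusCover]

/-- The covering maps Lebesgue measure on the period cube to a finite multiple of the Haar measure:
it rescales the cube to side `1` and then takes the quotient by `ℤ^d`. -/
theorem exists_map_torusCover {d : ℕ} : ∃ c : ℝ≥0∞, c ≠ ∞ ∧
    Measure.map torusCover (volume.restrict (periodCube d)) = c • volume := by
  have hπ := Real.pi_pos
  have hr : (2 * Real.pi)⁻¹ ≠ 0 := by positivity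
  let e := (MeasurableEquiv.toLp 2 (Fin d → ℝ)).symm
  let sc : (Fin d → ℝ) → (Fin d → ℝ) := fun y => (2 * Real.pi)⁻¹ • y
  let mk : (Fin d → ℝ) → UnitAddTorus (Fin d) := fun y i => (y i : UnitAddCircle)
  have hsc : Measurable sc := measurable_const_smul _
  have hmk : Measurable mk := measurable_pi_lambda _ fun i =>
    AddCircle.measurable_mk'.comp (measurable_pi_apply i)
  let S : Set (Fin d → ℝ) := Set.Icc (fun _ => -(1 / 2)) (fun _ => -(1 / 2) + 1)
  have hS : MeasurableSet S := measurableSet_Icc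
  have hQ : periodCube d = e ⁻¹' (sc ⁻¹' S) := by
    ext τ
    have he : ∀ i, e τ i = τ i := fun i => rfl
    simp only [periodCube, Set.mem_ofPred_eq, Set.mem_preimage, S, Set.mem_Icc, Pi.le_def, sc,
      Pi.smul_apply, he, smul_eq_mul, ← forall_and]
    refine forall_congr' fun i => ?_
    rw [le_inv_mul_iff₀ (by positivity), inv_mul_le_iff₀ (by positivity)]
    constructor <;> rintro ⟨h1, h2⟩ <;> constructor <;> linarith
  have h1 : Measure.map e (volume.restrict (periodCube d)) = volume.restrict (sc ⁻¹' S) := by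
    rw [hQ]
    exact ((EuclideanSpace.volume_preserving_symm_measurableEquiv_toLp (Fin d)).restrict_preimage
      (hsc hS)).map_eq
  have h2 : Measure.map sc (volume.restrict (sc ⁻¹' S))
      = ENNReal.ofReal |((2 * Real.pi)⁻¹ ^ Module.finrank ℝ (Fin d → ℝ))⁻¹| •
        volume.restrict S := by
    rw [← Measure.restrict_map hsc hS, Measure.map_addHaar_smul volume hr, Measure.restrict_smul]
  have h3 : Measure.map mk (volume.restrict S) = volume := by
    have hae : S =ᵐ[volume] {x : Fin d → ℝ | ∀ i, x i ∈ Set.Ioc (-(1 / 2) : ℝ) (-(1 / 2) + 1)} := by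
      have := (Measure.univ_pi_Ioc_ae_eq_Icc (μ := fun _ : Fin d => (volume : Measure ℝ))
        (f := fun _ => -(1 / 2)) (g := fun _ => -(1 / 2) + 1)).symm
      have heq : {x : Fin d → ℝ | ∀ i, x i ∈ Set.Ioc (-(1 / 2) : ℝ) (-(1 / 2) + 1)}
          = Set.univ.pi fun _ => Set.Ioc (-(1 / 2) : ℝ) (-(1 / 2) + 1) := by
        ext x; simp
      rw [heq]
      exact this
    rw [Measure.restrict_congr_set hae]
    ext A hA
    rw [Measure.map_apply hmk hA, ← lintegral_indicator_one hA,
      UnitAddTorus.lintegral_preimage _ (fun _ => -(1 / 2)), ← lintegral_indicator_one (hmk hA)]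
    rfl
  refine ⟨ENNReal.ofReal |((2 * Real.pi)⁻¹ ^ Module.finrank ℝ (Fin d → ℝ))⁻¹|,
    ENNReal.ofReal_ne_top, ?_⟩
  have hcomp : (torusCover : Euc d → UnitAddTorus (Fin d)) = mk ∘ sc ∘ e := rfl
  rw [hcomp, ← Measure.map_map hmk (hsc.comp e.measurable), ← Measure.map_map hsc e.measurable,
    h1, h2, Measure.map_smul, h3]

theorem exists_eLpNorm_comp_torusCover_eq {d : ℕ} : ∃ c : ℝ≥0∞, c ≠ ∞ ∧
    ∀ g : UnitAddTorus (Fin d) → ℂ, Measurable g →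
      eLpNorm (fun τ => g (torusCover τ)) 2 (volume.restrict (periodCube d))
        = c * eLpNorm g 2 volume := by
  obtain ⟨c, hc, hmap⟩ := exists_map_torusCover (d := d)
  refine ⟨c ^ (1 / 2 : ℝ), ENNReal.rpow_ne_top_of_nonneg (by norm_num) hc, fun g hg => ?_⟩
  have h := eLpNorm_map_measure (p := 2) (μ := volume.restrict (periodCube d))
    (f := torusCover) (g := g) hg.aestronglyMeasurable continuous_torusCover.measurable.aemeasurable
  rw [hmap] at h
  have h2 : eLpNorm g 2 (c • volume) = c ^ (1 / 2 : ℝ) * eLpNorm g 2 volume := by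
    rw [eLpNorm_smul_measure_of_ne_top ENNReal.ofNat_ne_top]
    simp
  rw [← h2, h]
  rfl

/-- The symbol on the torus, pulled back to `[-π, π]^d`, is the sum of the Fourier series in the sense
of `IsToeplitzSymbol`. -/
theorem CancellingKernel.isToeplitzSymbol {d : ℕ} [NeZero d] {K : Euc d → ℂ} {B : ℝ}
    (hK : CancellingKernel K B) : IsToeplitzSymbol K fun τ => torusSymbol K (torusCover τ) := by
  obtain ⟨M, -, hM⟩ := hK.exists_norm_torusSymbol_le
  obtain ⟨c, hc, hcomp⟩ := exists_eLpNorm_comp_torusCover_eq (d := d)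
  obtain ⟨f, hfF, hf⟩ := hK.exists_hasSum_torusSymbol
  have hmeas := measurable_torusSymbol K
  refine ⟨⟨?_, ?_⟩, ?_, ?_⟩
  · exact (hmeas.comp continuous_torusCover.measurable).aestronglyMeasurable
  · rw [hcomp _ hmeas, ← eLpNorm_congr_ae hfF]
    exact ENNReal.mul_lt_top hc.lt_top (Lp.memLp f).eLpNorm_lt_top
  · have hsub : HasSum (fun k : {m : Fin d → ℤ // m ≠ 0} =>
        K (latticePoint k.1) • UnitAddTorus.mFourierLp 2 k.1) f := by
      refine (hasSum_subtype_iff_of_support_subset (s := {m : Fin d → ℤ | m ≠ 0}) ?_).2 hf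
      intro k hk
      by_contra h0
      refine hk ?_
      change K (latticePoint k) • _ = _
      rw [of_not_not h0, latticePoint_zero, hK.map_zero]
      exact zero_smul ℂ _
    have hlim : Tendsto (fun s : Finset {m : Fin d → ℤ // m ≠ 0} =>
        c * ‖f - ∑ k ∈ s, K (latticePoint k.1) • UnitAddTorus.mFourierLp 2 k.1‖ₑ) atTop
        (𝓝 0) := by
      have h1 : Tendsto (fun s : Finset {m : Fin d → ℤ // m ≠ 0} =>
          f - ∑ k ∈ s, K (latticePoint k.1) • UnitAddTorus.mFourierLp 2 k.1) atTop (𝓝 0) := by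
        simpa using tendsto_const_nhds (x := f) |>.sub hsub
      have h2 := ENNReal.Tendsto.const_mul (a := c) (h1.enorm) (Or.inr hc)
      simpa using h2
    refine hlim.congr fun s => ?_
    let P : C(UnitAddTorus (Fin d), ℂ) :=
      ∑ k ∈ s, K (latticePoint k.1) • UnitAddTorus.mFourier k.1
    have hP : ∑ k ∈ s, K (latticePoint k.1) • UnitAddTorus.mFourierLp (d := Fin d) 2 k.1
        = ContinuousMap.toLp (E := ℂ) 2 volume ℂ P := by
      rw [map_sum]
      exact Finset.sum_congr rfl fun k _ =>
        ((ContinuousMap.toLp (E := ℂ) 2 volume ℂ).map_smul _ _).symm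
    have hPt : ∀ τ : Euc d, P (torusCover τ) = ∑ m ∈ s, K (latticePoint m.1) *
        Complex.exp (Complex.I * ((inner ℝ (latticePoint m.1) τ : ℝ) : ℂ)) := by
      intro τ
      simp only [P, ContinuousMap.sum_apply, ContinuousMap.smul_apply, mFourier_torusCover,
        smul_eq_mul]
    simp only [← hPt]
    rw [hcomp (fun t => torusSymbol K t - P t) (hmeas.sub P.continuous.measurable), hP,
      Lp.enorm_def]
    congr 1
    refine eLpNorm_congr_ae ?_
    filter_upwards [hfF, Lp.coeFn_sub f (ContinuousMap.toLp (E := ℂ) 2 volume ℂ P),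
      ContinuousMap.coeFn_toLp (p := 2) (𝕜 := ℂ) (volume : Measure (UnitAddTorus (Fin d))) P]
      with t e1 e2 e3
    rw [e2, Pi.sub_apply, e1, e3]
  · intro τ hτ
    exact ((continuousAt_torusSymbol K (torusCover_ne_zero hτ.1 hτ.2)).comp
      continuous_torusCover.continuousAt).continuousWithinAt

/-! ### Numerical range and resolvent -/

/-- A bounded operator whose quadratic form obeys all affine bounds valid on a closed convex set has
its numerical range in that set. -/
theorem numericalRange_subset_of_affine_bounds {H : Type*} [NormedAddCommGroup H]
    [InnerProductSpace ℂ H] {T : H →L[ℂ] H} {C : Set ℂ} (hconv : Convex ℝ C) (hclosed : IsClosed C)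
    (h : ∀ (l : ℂ →L[ℝ] ℝ) (s : ℝ), (∀ c ∈ C, l c ≤ s) →
      ∀ u, l (inner ℂ u (T u)) ≤ s * ‖u‖ ^ 2) : numericalRange T ⊆ C := by
  rintro z ⟨u, hu, rfl⟩
  by_contra hz
  obtain ⟨l, s, hl, hs⟩ := geometric_hahn_banach_closed_point hconv hclosed hz
  have := h l s (fun c hc => (hl c hc).le) u
  rw [hu] at this
  linarith

/-- The resolvent bound off a closed set containing the numerical range: `z - T` is bounded below,
and its range is dense because the same bound applies to the quadratic form. -/
theorem mem_resolventSet_of_numericalRange_subset {H : Type*} [NormedAddCommGroup H]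
    [InnerProductSpace ℂ H] [CompleteSpace H] {T : H →L[ℂ] H} {C : Set ℂ} (hclosed : IsClosed C)
    (hne : C.Nonempty) (hT : numericalRange T ⊆ C) {z : ℂ} (hz : z ∉ C) :
    z ∈ resolventSet ℂ T ∧ ‖resolvent T z‖ ≤ (Metric.infDist z C)⁻¹ := by
  set δ := Metric.infDist z C
  have hδ : 0 < δ := (hclosed.notMem_iff_infDist_pos hne).1 hz
  set S : H →L[ℂ] H := algebraMap ℂ (H →L[ℂ] H) z - T with hSdef
  have hSapply : ∀ u, S u = z • u - T u := fun u => by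
    rw [hSdef, sub_apply, Algebra.algebraMap_eq_smul_one]; rfl
  have hform : ∀ u, δ * ‖u‖ ^ 2 ≤ ‖(inner ℂ u (S u) : ℂ)‖ := by
    intro u
    rcases eq_or_ne u 0 with rfl | hu
    · simp
    have hu' : ‖u‖ ≠ 0 := norm_ne_zero_iff.2 hu
    let v : H := ((‖u‖ : ℂ)⁻¹) • u
    have hv : ‖v‖ = 1 := by
      rw [norm_smul, norm_inv, Complex.norm_real, norm_norm, inv_mul_cancel₀ hu']
    have h1 : δ ≤ ‖(inner ℂ v (S v) : ℂ)‖ := by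
      have h2 := Metric.infDist_le_dist_of_mem (x := z) (hT ⟨v, hv, rfl⟩)
      rw [hSapply, inner_sub_right, inner_smul_right, inner_self_eq_norm_sq_to_K, hv]
      simpa [dist_eq_norm] using h2
    have h3 : u = (‖u‖ : ℂ) • v := by
      rw [smul_smul, mul_inv_cancel₀ (by exact_mod_cast hu'), one_smul]
    have h4 : ‖(inner ℂ u (S u) : ℂ)‖ = ‖u‖ ^ 2 * ‖(inner ℂ v (S v) : ℂ)‖ := by
      conv_lhs => rw [h3]
      rw [map_smul, inner_smul_left, inner_smul_right, norm_mul, norm_mul, Complex.norm_conj,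
        Complex.norm_real, norm_norm]
      ring
    rw [h4, mul_comm]
    gcongr
  have hlow : ∀ u, δ * ‖u‖ ≤ ‖S u‖ := by
    intro u
    rcases eq_or_ne u 0 with rfl | hu
    · simp
    have hu' : 0 < ‖u‖ := norm_pos_iff.2 hu
    have := (hform u).trans (norm_inner_le_norm u (S u))
    rw [pow_two, ← mul_assoc, mul_comm ‖u‖ ‖S u‖] at this
    exact le_of_mul_le_mul_right this hu'
  have hanti : AntilipschitzWith (Real.toNNReal δ⁻¹) S := by
    refine S.antilipschitz_of_bound fun u => ?_
    rw [Real.coe_toNNReal _ (by positivity), le_inv_mul_iff₀ hδ]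
    exact hlow u
  have hker : S.ker = ⊥ := LinearMap.ker_eq_bot.2 hanti.injective
  have hrange : S.range = ⊤ := by
    have hcl : IsClosed (S.range : Set H) := by
      have h := hanti.isClosed_range S.uniformContinuous
      exact h
    have : CompleteSpace S.range := hcl.completeSpace_coe
    rw [← Submodule.orthogonal_eq_bot_iff, Submodule.eq_bot_iff]
    intro u hu
    have h0 : (inner ℂ u (S u) : ℂ) = 0 :=
      (Submodule.mem_orthogonal' _ _).1 hu (S u) (LinearMap.mem_range_self _ u)
    have h1 := hform u
    rw [h0, norm_zero] at h1
    by_contra hne0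
    have : 0 < ‖u‖ := norm_pos_iff.2 hne0
    have : 0 < δ * ‖u‖ ^ 2 := by positivity
    linarith
  let R := ContinuousLinearEquiv.ofBijective S hker hrange
  have hR : ((R : H →L[ℂ] H)) = S := ContinuousLinearEquiv.coe_ofBijective S hker hrange
  have hunit : IsUnit S := ⟨ContinuousLinearEquiv.toUnit R, hR⟩
  refine ⟨hunit, ?_⟩
  rw [resolvent]
  refine ContinuousLinearMap.opNorm_le_bound _ (by positivity) fun u => ?_
  have h1 : S (Ring.inverse S u) = u := by
    have := Ring.mul_inverse_cancel S hunit
    exact congrArg (fun L : H →L[ℂ] H => L u) this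
  have h2 := hlow (Ring.inverse S u)
  rw [h1] at h2
  rw [le_inv_mul_iff₀ hδ]
  exact h2

/-- By homogeneity the matrix entries depend only on the index difference. -/
theorem CancellingKernel.ddEntry_eq {d : ℕ} {K : Euc d → ℂ} {B : ℝ}
    (hK : CancellingKernel K B) (a : Euc d) {N : ℕ} (hN : 1 ≤ N) (m n : Fin d → ℤ) :
    ddEntry K a N m n = K (latticePoint (m - n)) := by
  rw [ddEntry]
  split_ifs with h
  · rw [h, sub_self, latticePoint_zero, hK.map_zero]
  · rw [hK.apply_latticePoint hN]
    congr 2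
    rw [gridPoint, gridPoint, add_sub_add_left_eq_sub, ← smul_sub, ← latticePoint_sub, one_div]
    rfl

theorem theoremT (d : ℕ) (hd : 1 ≤ d) (p : MvPolynomial (Fin d) ℂ) (hp : p.IsHomogeneous 2)
    (hcancel : SphericalCancellation (polyKernel p)) :
    ∃ (F : EuclideanSpace ℝ (Fin d) → ℂ) (C : Set ℂ),
      IsToeplitzSymbol (polyKernel p) F ∧
      C = closure (convexHull ℝ (F '' (periodCube d \ {0}))) ∧
      IsCompact C ∧ Convex ℝ C ∧
      (∀ (Ω : Set (EuclideanSpace ℝ (Fin d))), IsOpen Ω →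
        ∀ (a : EuclideanSpace ℝ (Fin d)) (N : ℕ), 1 ≤ N →
          (∀ z : ℂ, z ∉ C → ∀ f : ell2 (gridIndex Ω a N),
            ∃! U : ell2 (gridIndex Ω a N), SolvesDD (polyKernel p) Ω a N z f U) ∧
          ∃ T : ell2 (gridIndex Ω a N) →L[ℂ] ell2 (gridIndex Ω a N),
            IsDDOperator (polyKernel p) Ω a N T ∧
            ∀ z : ℂ, z ∉ C →
              z ∈ resolventSet ℂ T ∧ ‖resolvent T z‖ ≤ (Metric.infDist z C)⁻¹) ∧
      (∃! A : L2Space d →L[ℂ] L2Space d, IsPVConvolution (polyKernel p) A) ∧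
      ∀ A : L2Space d →L[ℂ] L2Space d, IsPVConvolution (polyKernel p) A →
        numericalRange A ⊆ C := by
  have : NeZero d := ⟨by omega⟩
  obtain ⟨B, hK⟩ := polyKernel_cancellingKernel hd hp hcancel
  set K := polyKernel p
  obtain ⟨M, -, hM⟩ := hK.exists_norm_torusSymbol_le
  obtain ⟨M', -, hT⟩ := hK.exists_toeplitz
  obtain ⟨A, hA, hAuniq, hAl⟩ := hK.exists_isPVConvolution
  let F : Euc d → ℂ := fun τ => torusSymbol K (torusCover τ)
  set C := closure (convexHull ℝ (F '' (periodCube d \ {0}))) with hC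
  have hclosed : IsClosed C := isClosed_closure
  have hconv : Convex ℝ C := (convex_convexHull ℝ _).closure
  have hsym : ∀ t, t ≠ 0 → torusSymbol K t ∈ C := by
    intro t ht
    obtain ⟨τ, hτ, rfl⟩ := exists_torusCover_eq ht
    exact subset_closure (subset_convexHull ℝ _ ⟨τ, hτ, rfl⟩)
  have hne : C.Nonempty := by
    have hπ := Real.pi_pos
    refine ⟨F (EuclideanSpace.single ⟨0, hd⟩ Real.pi), subset_closure (subset_convexHull ℝ _
      ⟨_, ⟨fun i => ?_, ?_⟩, rfl⟩)⟩
    · by_cases h : i = ⟨0, hd⟩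
      · subst h; simp; linarith
      · have h0 : EuclideanSpace.single (⟨0, hd⟩ : Fin d) Real.pi i = 0 := by
          rw [PiLp.single_apply, if_neg h]
        rw [h0]
        exact ⟨by linarith, hπ.le⟩
    · simp [Real.pi_ne_zero]
  have hcompact : IsCompact C := by
    refine Metric.isCompact_of_isClosed_isBounded hclosed
      (Bornology.IsBounded.closure (isBounded_convexHull.2 ?_))
    refine (Metric.isBounded_closedBall (x := (0 : ℂ)) (r := M)).subset ?_
    rintro _ ⟨τ, -, rfl⟩
    simpa using hM (torusCover τ)
  refine ⟨F, C, hK.isToeplitzSymbol, rfl, hcompact, hconv, ?_, ⟨A, hA, fun A' hA' =>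
    hAuniq A' hA'⟩, ?_⟩
  · intro Ω _ a N hN
    obtain ⟨T, hTsum, -, hTl⟩ := hT (gridIndex Ω a N) Subtype.val Subtype.val_injective
    have hDD : IsDDOperator K Ω a N T := by
      intro U m
      simp only [hK.ddEntry_eq a hN]
      exact hTsum U m
    have hres : ∀ z : ℂ, z ∉ C →
        z ∈ resolventSet ℂ T ∧ ‖resolvent T z‖ ≤ (Metric.infDist z C)⁻¹ := fun z hz =>
      mem_resolventSet_of_numericalRange_subset hclosed hne
        (numericalRange_subset_of_affine_bounds hconv hclosed fun l s hls u =>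
          hTl l s (fun t ht => hls _ (hsym t ht)) u) hz
    refine ⟨fun z hz f => ?_, T, hDD, hres⟩
    have hunit : IsUnit (algebraMap ℂ (ell2 (gridIndex Ω a N) →L[ℂ] ell2 (gridIndex Ω a N)) z
      - T) := (hres z hz).1
    set S := algebraMap ℂ (ell2 (gridIndex Ω a N) →L[ℂ] ell2 (gridIndex Ω a N)) z - T with hS
    have hSapply : ∀ U, S U = z • U - T U := fun U => by
      rw [hS, sub_apply, Algebra.algebraMap_eq_smul_one]; rfl
    have hiff : ∀ U, SolvesDD K Ω a N z f U ↔ S U = f := by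
      intro U
      constructor
      · intro h
        ext m
        obtain ⟨s, hs, hs'⟩ := h m
        rw [hSapply, ← hs', hs.unique (hDD U m)]
        rfl
      · intro h m
        refine ⟨T U m, hDD U m, ?_⟩
        rw [← h, hSapply]
        rfl
    have hr : S * Ring.inverse S = 1 := Ring.mul_inverse_cancel S hunit
    have hl : Ring.inverse S * S = 1 := Ring.inverse_mul_cancel S hunit
    refine ⟨Ring.inverse S f, (hiff _).2 (congrArg (fun L => L f) hr), fun U hU => ?_⟩
    rw [← (hiff U).1 hU]
    exact (congrArg (fun L => L U) hl).symm
  · intro A' hA'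
    rw [hAuniq A' hA']
    exact numericalRange_subset_of_affine_bounds hconv hclosed fun l s hls u =>
      hAl l s (fun t ht => hls _ (hsym t ht)) u
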